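/- Let \((F_i)_{i\in I}\) be a class of finite fields. Say that exponent \(\tau\) is achieved over the class if there is a constant \(C\) such that for all \(i\in I\) and \(m\ge 1\) the product of two \(m\times m\) matrices over \(F_i\) can be computed by a bilinear algebraic algorithm of rank at most \(C m^{\tau}\), and let \(\omega\) be the exponent of matrix multiplication over the class, i.e. the least \(\tau\) such that \(\tau+\varepsilon\) is achieved for every \(\varepsilon>0\). Fix constants \(c>0\), \(K\) and \(k\), and consider all \(n\ge 1\) and \(F=F_i\) with \[ c\,n^2\log n\le |F|\le K n^{k}. \] Consider the congested clique with \(n\) nodes: in each synchronous round every node sends one message of \(\beta\lceil\log_2 n\rceil\) bits to every node (\(\beta\ge1\) any fixed integer), nodes have private randomness, and local computation is free. Consider the following three problems, where initially node \(\ell\) knows the \(\ell\)-th row and the \(\ell\)-th column of a matrix \(A\in F^{n\times n}\). - \(\mathrm{DET}(n,F)\): every node outputs \(\det A\). - \(\mathrm{SYS}(n,F)\): \(A\) is invertible, every node also knows a vector \(b\in F^n\), and node \(\ell\) outputs \(x[\ell]\), where \(Ax=b\). - \(\mathrm{Rank}(n,F)\): every node outputs \(\mathrm{rank}(A)\). Each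 of the three problems is solved by randomized algorithms in \(O(n^{1-2/\omega}\log n)\) rounds, where, as usual, \(n^{\omega}\) stands for \(n^{\omega+o(1)}\): precisely, in \(O(n^{1-2/\omega+\varepsilon}\log n)\) rounds for every \(\varepsilon>0\), and in \(O(n^{1-2/\tau}\log n)\) rounds for every achieved exponent \(\tau\). On every input the outputs of all nodes are correct except with probability at most \(\min\{1/3,\,O(1/\log n)\}\). The implied constants do not depend on \(n\) or on the field in the class. -/

import Mathlib

universe u v w

/-! ## The congested clique model -/

namespace CongestedClique

/-- A message: a bit string of length `β * ⌈log₂ n⌉`, i.e. `O(log n)` bits. -/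
abbrev Message (β n : ℕ) : Type := Fin (β * Nat.clog 2 n) → Bool

/-- A distributed problem for a network of `n` nodes: which part of the instance each node knows
initially, and which families of local outputs are correct for an instance. -/
structure Problem (n : ℕ) where
  Instance : Type u
  LocalInput : Type u
  LocalOutput : Type w
  localInput : Instance → Fin n → LocalInput
  Correct : Instance → (Fin n → LocalOutput) → Prop

/-- A randomized algorithm in the congested clique with `n` nodes. Every node has private coins,
drawn uniformly from a finite set, and a state that initially depends only on its own input and
its own coins. In each synchronous round every node sends one message to every node, and then
updates its state with the messages it received. Local computation is unrestricted. -/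
structure Protocol (n β : ℕ) (LocalInput : Type u) (LocalOutput : Type w) where
  Coin : Type u
  coin_finite : Finite Coin
  coin_nonempty : Nonempty Coin
  State : Type u
  init : Fin n → LocalInput → Coin → State
  /-- `send ℓ s ℓ'` is the message that node `ℓ` in state `s` sends to node `ℓ'`. -/
  send : Fin n → State → Fin n → Message β n
  /-- `receive ℓ s m` is the new state of node `ℓ` in state `s`; `m ℓ'` comes from node `ℓ'`. -/
  receive : Fin n → State → (Fin n → Message β n) → State
  output : Fin n → State → LocalOutput

namespace Protocol

variable {n β : ℕ} {I : Type u} {O : Type w}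

/-- The states of all nodes after `t` rounds. -/
def stateAfter (P : Protocol n β I O) (x : Fin n → I) (r : Fin n → P.Coin) :
    ℕ → Fin n → P.State
  | 0 => fun l => P.init l (x l) (r l)
  | t + 1 => fun l =>
      P.receive l (stateAfter P x r t l) (fun l' => P.send l' (stateAfter P x r t l') l)

/-- The outputs of all nodes when the protocol is stopped after `T` rounds. -/
def run (P : Protocol n β I O) (T : ℕ) (x : Fin n → I) (r : Fin n → P.Coin) : Fin n → O :=
  fun l => P.output l (P.stateAfter x r T l)

end Protocol

/-- The probability, over independent uniform coins of the nodes, that the outputs after `T` rounds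
on instance `X` are not correct. -/
noncomputable def failureProb {n β : ℕ} (prob : Problem.{u, w} n)
    (P : Protocol n β prob.LocalInput prob.LocalOutput) (T : ℕ) (X : prob.Instance) : ℝ :=
  (Set.ncard {r : Fin n → P.Coin | ¬ prob.Correct X (P.run T (prob.localInput X) r)} : ℝ) /
    (Nat.card (Fin n → P.Coin) : ℝ)

/-- Some protocol with messages of `β * ⌈log₂ n⌉` bits solves the problem in `T` rounds, with
failure probability at most `δ` on every instance. -/
def SolvableInRounds {n : ℕ} (prob : Problem.{u, w} n) (β T : ℕ) (δ : ℝ) : Prop :=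
  ∃ P : Protocol n β prob.LocalInput prob.LocalOutput,
    ∀ X : prob.Instance, failureProb prob P T X ≤ δ

/-- The problems `prob n i`, for the pairs `(n, i)` in `Adm`, have randomized round complexity
`O(f n)`: up to `C * f n` rounds, and failure probability at most `1/3` and at most `D / log n`.
The constants do not depend on `n` and `i`. -/
def RandomizedRoundComplexityO {ι : Type v} (Adm : ℕ → ι → Prop)
    (prob : (n : ℕ) → ι → Problem.{u, w} n) (β : ℕ) (f : ℕ → ℝ) : Prop :=
  ∃ C D : ℝ, ∀ (n : ℕ) (i : ι), Adm n i →
    ∃ (T : ℕ) (δ : ℝ), (T : ℝ) ≤ C * f n ∧ δ ≤ 1 / 3 ∧ δ * Real.log n ≤ D ∧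
      SolvableInRounds (prob n i) β T δ

/-! ## The algebraic problems -/

/-- Node `l` knows the row `A[l,*]` and the column `A[*,l]`. -/
def rowAndColumn {n : ℕ} {F : Type u} (A : Matrix (Fin n) (Fin n) F) (l : Fin n) :
    (Fin n → F) × (Fin n → F) :=
  (fun j => A l j, fun j => A j l)

/-- Determinant: every node outputs `det A`. -/
def DET (n : ℕ) (F : Type u) [Field F] : Problem.{u, u} n where
  Instance := Matrix (Fin n) (Fin n) F
  LocalInput := (Fin n → F) × (Fin n → F)
  LocalOutput := F
  localInput := rowAndColumn
  Correct A out := ∀ l, out l = A.det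

/-- Rank: every node outputs `rank A`. -/
def RANK (n : ℕ) (F : Type u) [Field F] : Problem.{u, 0} n where
  Instance := Matrix (Fin n) (Fin n) F
  LocalInput := (Fin n → F) × (Fin n → F)
  LocalOutput := ℕ
  localInput := rowAndColumn
  Correct A out := ∀ l, out l = A.rank

/-- Nonsingular linear system: every node also knows `b`, and node `l` outputs `x l`, where
`A x = b`. -/
def SYS (n : ℕ) (F : Type u) [Field F] : Problem.{u, u} n where
  Instance := {A : Matrix (Fin n) (Fin n) F // IsUnit A} × (Fin n → F)
  LocalInput := ((Fin n → F) × (Fin n → F)) × (Fin n → F)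
  LocalOutput := F
  localInput X l := (rowAndColumn X.1.1 l, X.2)
  Correct X out := Matrix.mulVec X.1.1 out = X.2

/-! ## The exponent of matrix multiplication -/

/-- There is a bilinear algebraic algorithm of rank `t` for the product of two `m × m` matrices
over `F`, given by its coefficients `α`, `γ`, `lam`. -/
def HasMatMulAlgorithm (F : Type u) [Field F] (m t : ℕ) : Prop :=
  ∃ α γ lam : Fin m → Fin m → Fin t → F, ∀ (A B : Matrix (Fin m) (Fin m) F) (i j : Fin m),
    (A * B) i j = ∑ μ, lam i j μ *
      (∑ i', ∑ j', α i' j' μ * A i' j') * (∑ i', ∑ j', γ i' j' μ * B j' i')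

/-- Uniformly over the fields `F i`, products of `m × m` matrices can be computed by algebraic
algorithms of rank `O(m ^ τ)`. -/
def MatMulRankO {ι : Type v} (F : ι → Type u) [∀ i, Field (F i)] (τ : ℝ) : Prop :=
  ∃ C : ℝ, ∀ (i : ι) (m : ℕ), 1 ≤ m →
    ∃ t : ℕ, (t : ℝ) ≤ C * (m : ℝ) ^ τ ∧ HasMatMulAlgorithm (F i) m t

/-- The exponent `ω` of matrix multiplication over the fields `F i`: the minimal `τ` such that
rank `O(m ^ (τ + ε))` is possible for every `ε > 0`. -/
noncomputable def matMulExponent {ι : Type v} (F : ι → Type u) [∀ i, Field (F i)] : ℝ :=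
  sInf {τ : ℝ | ∀ ε : ℝ, 0 < ε → MatMulRankO F (τ + ε)}

/-- `c n² log n ≤ |F i| ≤ K n ^ k`, for a network with `n ≥ 1` nodes. -/
def FieldSizeAdmissible {ι : Type v} (F : ι → Type u) (c K : ℝ) (k : ℕ) (n : ℕ) (i : ι) : Prop :=
  1 ≤ n ∧ c * (n : ℝ) ^ 2 * Real.log n ≤ (Nat.card (F i) : ℝ) ∧
    (Nat.card (F i) : ℝ) ≤ K * (n : ℝ) ^ k

end CongestedClique

open CongestedClique

/-!
Wiedemann's algorithm, with the matrix products distributed over the nodes.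

A bilinear algorithm of rank `t ≈ n` for `d × d` matrices, `d ≈ n ^ (1 / τ)`, reduces an `n × n`
product to `t` products of blocks with `n ^ (2 - 2 / τ)` entries. Every node performs one of them,
and routing the blocks takes `O(n ^ (1 - 2 / τ))` rounds.

For a random matrix `U` and random vectors `u` and `v`, put `B = A U`. The Hankel matrix with the
entries `uᵀ Bⁱ⁺ʲ⁺ᶜ v` is the product of the Krylov matrix with rows `uᵀ Bⁱ`, of `Bᶜ`, and of the
Krylov matrix with columns `Bʲ v`. Hence, when the Hankel matrix for `c = 1` of order `rank A` is
invertible, its counterparts of order `n` for `c = 0, 1` determine `rank A`, `det B` and, for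
`v = b`, the solution of `B y = b`. Its determinant is a polynomial of degree at most `3 n²` in the
random entries, and it is not the zero polynomial, because `U` can make `A U` act as a cyclic shift
on `rank A` vectors spanning the range of `A`; so it vanishes with probability at most `3 n² / |F|`.
Krylov matrices take `O(log n)` matrix products, by repeated doubling: `Bᵐ` times the columns
`Bʲ v`, `j < m`, gives the next `m` columns.

Where `n² / |F|` is not small, `n` is bounded, and the nodes exchange the whole input.
-/

namespace CongestedClique

/-- `Reach β T X Y`: in `T` rounds the nodes can pass from the distributed data `X` to the
distributed data `Y`, where `X ω l` is what node `l` knows in the global situation `ω`. -/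
inductive Reach {n : ℕ} (β : ℕ) {Ω : Type*} :
    ℕ → ∀ {S : Type u} {S' : Type w}, (Ω → Fin n → S) → (Ω → Fin n → S') → Prop
  | of_local {S : Type u} {S' : Type w} {X : Ω → Fin n → S} {Y : Ω → Fin n → S'}
      (g : Fin n → S → S') (h : ∀ ω l, Y ω l = g l (X ω l)) : Reach β 0 X Y
  | round {T : ℕ} {S : Type u} {S' : Type w} {X : Ω → Fin n → S} {Y : Ω → Fin n → S'}
      (send : Fin n → S → Fin n → Message β n)
      (h : Reach β T (fun ω l => (X ω l, fun l' => send l' (X ω l') l)) Y) :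
      Reach β (T + 1) X Y

namespace Reach

variable {n β : ℕ} {Ω S S₁ S₂ : Type*} {T T₁ T₂ : ℕ} {X : Ω → Fin n → S}
  {Y : Ω → Fin n → S₁} {Z : Ω → Fin n → S₂}

lemma comap (hYZ : Reach β T Y Z) (g : Fin n → S → S₁) (h : ∀ ω l, Y ω l = g l (X ω l)) :
    Reach β T X Z := by
  induction hYZ generalizing S with
  | of_local f hf => exact .of_local (fun l s => f l (g l s)) fun ω l => by rw [hf, h]
  | round send _ ih =>
    exact .round (fun l s => send l (g l s)) <|
      ih (fun l p => (g l p.1, p.2)) fun ω l => by simp only [h]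

lemma trans (hXY : Reach β T₁ X Y) (hYZ : Reach β T₂ Y Z) : Reach β (T₁ + T₂) X Z := by
  induction hXY with
  | of_local g h => exact (Nat.zero_add T₂).symm ▸ hYZ.comap g h
  | @round T₁ _ _ _ _ send _ ih => exact Nat.add_right_comm T₁ 1 T₂ ▸ .round send (ih hYZ)

lemma map (hXY : Reach β T X Y) (g : Fin n → S₁ → S₂) (h : ∀ ω l, Z ω l = g l (Y ω l)) :
    Reach β T X Z :=
  hXY.trans (.of_local g h)

lemma keep (hXY : Reach β T X Y) : Reach β T X fun ω l => (X ω l, Y ω l) := by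
  induction hXY with
  | of_local g h => exact .of_local (fun l s => (s, g l s)) fun ω l => by rw [h]
  | round send _ ih => exact .round send (ih.map (fun _ p => (p.1.1, p.2)) fun _ _ => rfl)

lemma mono (hXY : Reach β T₁ X Y) (hT : T₁ ≤ T₂) : Reach β T₂ X Y := by
  induction hT with
  | refl => exact hXY
  | step _ ih => exact .round (fun _ _ _ _ => false) (ih.comap (fun _ p => p.1) fun _ _ => rfl)

lemma prod (hXY : Reach β T₁ X Y) (hXZ : Reach β T₂ X Z) :
    Reach β (T₁ + T₂) X fun ω l => (Y ω l, Z ω l) := by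
  have hZ : Reach β T₂ (fun ω l => (X ω l, Y ω l)) Z := hXZ.comap (fun _ p => p.1) fun _ _ => rfl
  exact (hXY.keep.trans hZ.keep).map (fun _ p => (p.1.2, p.2)) fun _ _ => rfl

lemma pi {k : ℕ} {Y : Fin k → Ω → Fin n → S₁} (h : ∀ i, Reach β T X (Y i)) :
    Reach β (k * T) X fun ω l i => Y i ω l := by
  induction k with
  | zero =>
    rw [Nat.zero_mul]
    exact .of_local (fun _ _ i => i.elim0) fun _ _ => funext fun i => i.elim0
  | succ k ih =>
    have hcons := (h 0).prod (ih fun i => h i.succ)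
    rw [Nat.succ_mul, Nat.add_comm]
    exact hcons.map (fun _ p => Fin.cons p.1 p.2)
      fun ω l => funext <| Fin.cases (by simp) (by simp)

end Reach

/-- The elements of `V` can be encoded by `w` messages of the congested clique. -/
def FitsInMessages (n β w : ℕ) (V : Type*) : Prop :=
  Nat.card V ≤ 2 ^ (β * Nat.clog 2 n * w)

lemma FitsInMessages.nonempty_embedding {n β w : ℕ} {V : Type*} [Finite V]
    (hV : FitsInMessages n β w V) : Nonempty (V ↪ (Fin w → Message β n)) := by
  have := Fintype.ofFinite V
  apply Function.Embedding.nonempty_of_card_le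
  simpa [FitsInMessages, Message, pow_mul] using hV

lemma Reach.exchange {n β w : ℕ} {Ω S V : Type*} [Finite V] [Nonempty V]
    (hV : FitsInMessages n β w V) (X : Ω → Fin n → S) (send : Fin n → S → Fin n → V) :
    Reach β w X fun ω l l' => send l' (X ω l') l := by
  obtain ⟨e⟩ := hV.nonempty_embedding
  have hround (i : Fin w) : Reach β 1 X fun ω l l' => e (send l' (X ω l') l) i :=
    .round (fun l s l' => e (send l s l') i) (.of_local (fun _ p => p.2) fun _ _ => rfl)
  have hpi := Reach.pi hround
  rw [mul_one] at hpi
  exact hpi.map (fun _ p l' => Function.invFun e fun i => p i l')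
    fun ω l => funext fun l' => (Function.leftInverse_invFun e.injective _).symm

lemma Reach.broadcast {n β w : ℕ} {Ω V : Type*} [Finite V] [Nonempty V]
    (hV : FitsInMessages n β w V) (a : Ω → Fin n → V) : Reach β w a fun ω _ => a ω :=
  exchange hV a fun _ s _ => s

namespace Protocol

variable {n β : ℕ} {I : Type u} {O : Type w}

/-- The protocol without communication and coins. -/
def ofLocal (β : ℕ) (g : Fin n → I → O) : Protocol n β I O where
  Coin := PUnit
  coin_finite := inferInstance
  coin_nonempty := inferInstance
  State := I
  init _ x _ := x
  send _ _ _ _ := false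
  receive _ s _ := s
  output := g

/-- The protocol that sends the messages `send l x` of the inputs `x`, and then runs `P` on the
inputs and the received messages. A state `Sum.inl` is that of a node still before its first
round. -/
def sendFirst (send : Fin n → I → Fin n → Message β n)
    (P : Protocol n β (I × (Fin n → Message β n)) O) : Protocol n β I O where
  Coin := P.Coin
  coin_finite := P.coin_finite
  coin_nonempty := P.coin_nonempty
  State := (I × P.Coin) ⊕ P.State
  init _ x r := .inl (x, r)
  send l := Sum.elim (fun s => send l s.1) (P.send l)
  receive l s m := .inr (s.elim (fun s => P.init l (s.1, m) s.2) fun s => P.receive l s m)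
  output l := Sum.elim (fun s => P.output l (P.init l (s.1, fun _ _ => false) s.2)) (P.output l)

lemma sendFirst_stateAfter_succ (send : Fin n → I → Fin n → Message β n)
    (P : Protocol n β (I × (Fin n → Message β n)) O) (x : Fin n → I) (r : Fin n → P.Coin) (t : ℕ) :
    (sendFirst send P).stateAfter x r (t + 1) =
      fun l => .inr (P.stateAfter (fun l => (x l, fun l' => send l' (x l') l)) r t l) := by
  induction t with
  | zero => rfl
  | succ t ih =>
    exact congrArg (fun σ l => (sendFirst send P).receive l (σ l) fun l' =>
      (sendFirst send P).send l' (σ l') l) ih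

lemma sendFirst_run_succ (send : Fin n → I → Fin n → Message β n)
    (P : Protocol n β (I × (Fin n → Message β n)) O) (T : ℕ) (x : Fin n → I)
    (r : Fin n → P.Coin) :
    (sendFirst send P).run (T + 1) x r =
      P.run T (fun l => (x l, fun l' => send l' (x l') l)) r :=
  funext fun l => congrArg ((sendFirst send P).output l)
    (congrFun (sendFirst_stateAfter_succ send P x r T) l)

/-- The protocol that runs `P`, with its own coins fixed arbitrarily, on the inputs together with
new coins. -/
noncomputable def withCoins (Coin : Type u) [Finite Coin] [Nonempty Coin]
    (P : Protocol n β (I × Coin) O) : Protocol n β I O where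
  Coin := Coin
  coin_finite := inferInstance
  coin_nonempty := inferInstance
  State := P.State
  init l x r := P.init l (x, r) P.coin_nonempty.some
  send := P.send
  receive := P.receive
  output := P.output

lemma withCoins_run (Coin : Type u) [Finite Coin] [Nonempty Coin]
    (P : Protocol n β (I × Coin) O) (T : ℕ) (x : Fin n → I) (r : Fin n → Coin) :
    (withCoins Coin P).run T x r = P.run T (fun l => (x l, r l)) fun _ => P.coin_nonempty.some := by
  have hstate (t : ℕ) : (withCoins Coin P).stateAfter x r t =
      P.stateAfter (fun l => (x l, r l)) (fun _ => P.coin_nonempty.some) t := by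
    induction t with
    | zero => rfl
    | succ t ih => funext l; simp only [stateAfter, ih]; rfl
  exact funext fun l => congrArg (P.output l) (congrFun (hstate T) l)

end Protocol

lemma Reach.exists_protocol {n β T : ℕ} {Ω : Type*} {I : Type u} {O : Type w}
    {X : Ω → Fin n → I} {Y : Ω → Fin n → O} (h : Reach β T X Y) :
    ∃ P : Protocol n β I O, ∀ ω r, P.run T (X ω) r = Y ω := by
  induction h with
  | of_local g h => exact ⟨.ofLocal β g, fun ω _ => funext fun l => (h ω l).symm⟩
  | round send _ ih =>
    obtain ⟨P, hP⟩ := ih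
    exact ⟨P.sendFirst send, fun ω r => (P.sendFirst_run_succ send _ _ r).trans (hP ω r)⟩

/-- The probability of a set under the uniform distribution on a finite type. -/
noncomputable def uniformProb {α : Type*} (s : Set α) : ℝ :=
  s.ncard / Nat.card α

lemma solvableInRounds_of_reach {n β T : ℕ} {prob : Problem.{u, w} n} {Coin : Type u}
    [Finite Coin] [Nonempty Coin] {δ : ℝ}
    {Y : prob.Instance × (Fin n → Coin) → Fin n → prob.LocalOutput}
    (hY : Reach β T (fun (ω : prob.Instance × (Fin n → Coin)) l =>
      (prob.localInput ω.1 l, ω.2 l)) Y)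
    (hδ : ∀ X, uniformProb {r | ¬ prob.Correct X (Y (X, r))} ≤ δ) :
    SolvableInRounds prob β T δ := by
  obtain ⟨P, hP⟩ := hY.exists_protocol
  refine ⟨P.withCoins Coin, fun X => (hδ X).trans' (le_of_eq ?_)⟩
  have hrun (r : Fin n → Coin) : (P.withCoins Coin).run T (prob.localInput X) r = Y (X, r) :=
    (P.withCoins_run Coin T _ r).trans (hP (X, r) _)
  unfold failureProb uniformProb
  simp only [← hrun]
  rfl

/-! ### Routing -/

/-- Greedy colouring: at most `G.degree v` colours are forbidden for the next vertex `v`. -/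
lemma nonempty_coloring_of_degree_lt {V C : Type*} [Fintype V] [Fintype C] (G : SimpleGraph V)
    [DecidableRel G.Adj] (h : ∀ v, G.degree v < Fintype.card C) : Nonempty (G.Coloring C) := by
  classical
  suffices hs : ∀ s : Finset V, ∃ col : V → C, ∀ v ∈ s, ∀ v' ∈ s, G.Adj v v' → col v ≠ col v' by
    obtain ⟨col, hcol⟩ := hs Finset.univ
    exact ⟨.mk col fun hadj => hcol _ (Finset.mem_univ _) _ (Finset.mem_univ _) hadj⟩
  intro s
  induction s using Finset.induction_on with
  | empty =>
    have hC (v : V) : Nonempty C := Fintype.card_pos_iff.1 (Nat.zero_lt_of_lt (h v))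
    exact ⟨fun v => (hC v).some, by simp⟩
  | insert v s hv ih =>
    obtain ⟨col, hcol⟩ := ih
    obtain ⟨c, -, hc⟩ : ∃ c ∈ Finset.univ, c ∉ (G.neighborFinset v).image col :=
      Finset.exists_mem_notMem_of_card_lt_card (Finset.card_image_le.trans_lt (h v))
    have hne {v'} (hadj : G.Adj v v') : col v' ≠ c := fun heq =>
      hc (Finset.mem_image.2 ⟨v', by simpa using hadj, heq⟩)
    have hs {v'} (hv' : v' ∈ s) : v' ≠ v := ne_of_mem_of_not_mem hv' hv
    refine ⟨Function.update col v c, fun x hx y hy hadj => ?_⟩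
    rcases Finset.mem_insert.1 hx with rfl | hxs <;> rcases Finset.mem_insert.1 hy with rfl | hys
    · exact absurd hadj (G.loopless.irrefl _)
    · simpa [hs hys] using (hne hadj).symm
    · simpa [hs hxs] using hne hadj.symm
    · simpa [hs hxs, hs hys] using hcol x hxs y hys hadj

lemma exists_conflictFree_coloring {J A B C : Type*} [Fintype J] [Fintype C] [DecidableEq A]
    [DecidableEq B] (src : J → A) (dst : J → B) {k : ℕ} (hC : 2 * k ≤ Fintype.card C)
    (hsrc : ∀ a, (Finset.univ.filter fun j => src j = a).card ≤ k)
    (hdst : ∀ b, (Finset.univ.filter fun j => dst j = b).card ≤ k) :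
    ∃ col : J → C, ∀ j j', (src j = src j' ∨ dst j = dst j') → col j = col j' → j = j' := by
  classical
  let G : SimpleGraph J := .fromRel fun j j' => src j = src j' ∨ dst j = dst j'
  have hdegree (j : J) : G.degree j < Fintype.card C := by
    let U := (Finset.univ.filter fun j' => src j' = src j) ∪
      Finset.univ.filter fun j' => dst j' = dst j
    have hsub : G.neighborFinset j ⊂ U := by
      refine (Finset.ssubset_iff_of_subset fun j' hj' => ?_).2 ⟨j, by simp [U], by simp⟩
      simp only [SimpleGraph.mem_neighborFinset, G, SimpleGraph.fromRel_adj] at hj'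
      simp only [U, Finset.mem_union, Finset.mem_filter_univ]
      grind
    calc G.degree j < U.card := Finset.card_lt_card hsub
      _ ≤ k + k := (Finset.card_union_le _ _).trans (Nat.add_le_add (hsrc _) (hdst _))
      _ ≤ Fintype.card C := by omega
  obtain ⟨col⟩ := nonempty_coloring_of_degree_lt G hdegree
  refine ⟨col, fun j j' hconflict => Function.mtr fun hne => col.valid ?_⟩
  exact (SimpleGraph.fromRel_adj _ _ _).2 ⟨hne, .inl hconflict⟩

/-- The part of the data `val` that is stored at the node `l`, when the entry `j` is stored at the
node `o j`; the other entries are replaced by zero. -/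
def owned {n : ℕ} {J F : Type*} [Zero F] (o : J → Fin n) (val : J → F) (l : Fin n) (j : J) : F :=
  if o j = l then val j else 0

namespace Reach

variable {n β w : ℕ} {Ω J F : Type*} [AddCommMonoid F] [Finite F]

lemma relay [Finite J] (hF : FitsInMessages n β w F) {src dst : J → Fin n} {q : ℕ}
    (κ : J → Fin q) (hκ : Function.Injective fun j => (src j, dst j, κ j))
    (val : Ω → J → F) :
    Reach β (q * w) (fun ω => owned src (val ω)) (fun ω => owned dst (val ω)) := by
  classical
  have := Fintype.ofFinite J
  have hsend := pi fun i : Fin q => exchange hF (fun ω => owned src (val ω))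
    fun _ s l' => ∑ j, if dst j = l' ∧ κ j = i then s j else 0
  refine hsend.map (fun l p j => if dst j = l then p (κ j) (src j) else 0) fun ω l => ?_
  funext j
  rw [owned]
  split_ifs with hj
  · beta_reduce
    rw [Finset.sum_eq_single j]
    · simp [owned, hj]
    · intro j' _ hne
      simp only [owned]
      split_ifs with hdst hsrc
      · exact absurd (hκ (Prod.ext hsrc (Prod.ext (hdst.1.trans hj.symm) hdst.2))) hne
      all_goals rfl
    · simp
  · rfl

/-- Each entry travels through the intermediate node given by its colour. -/
lemma route [Fintype J] (hF : FitsInMessages n β w F) {src dst : J → Fin n}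
    {q : ℕ} (hsrc : ∀ l, (Finset.univ.filter fun j => src j = l).card ≤ n * q)
    (hdst : ∀ l, (Finset.univ.filter fun j => dst j = l).card ≤ n * q) (val : Ω → J → F) :
    Reach β (4 * q * w) (fun ω => owned src (val ω)) (fun ω => owned dst (val ω)) := by
  have hcard : 2 * (n * q) ≤ Fintype.card (Fin n × Fin (2 * q)) :=
    le_of_eq (by rw [Fintype.card_prod, Fintype.card_fin, Fintype.card_fin, mul_left_comm])
  obtain ⟨col, hcol⟩ := exists_conflictFree_coloring src dst hcard hsrc hdst
  have hout := relay hF (src := src) (dst := fun j => (col j).1) (fun j => (col j).2)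
    (fun j j' h => hcol j j' (.inl (Prod.ext_iff.1 h).1) (Prod.ext_iff.1 h).2) val
  have hin := relay hF (src := fun j => (col j).1) (dst := dst) (fun j => (col j).2)
    (fun j j' h => hcol j j' (.inr (Prod.ext_iff.1 (Prod.ext_iff.1 h).2).1)
      (Prod.ext (Prod.ext_iff.1 h).1 (Prod.ext_iff.1 (Prod.ext_iff.1 h).2).2)) val
  exact (hout.trans hin).mono (le_of_eq (by ring))

lemma sum_all (hF : FitsInMessages n β w F) (a : Ω → Fin n → Fin n → F) :
    Reach β (2 * w) a fun ω _ j => ∑ l, a ω l j := by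
  have hsum : Reach β w a fun ω j => ∑ l, a ω l j :=
    (exchange hF a fun _ s => s).map (fun _ p => ∑ l, p l) fun _ _ => rfl
  exact (hsum.trans (broadcast hF _)).mono (by omega)

end Reach

/-! ### Distributed matrix multiplication -/

/-- When every node knows one row of each of two `n × n` matrices, then in `M` rounds every node
can learn its row of the product. -/
def MulRounds (n β : ℕ) (F : Type u) [Semiring F] (M : ℕ) : Prop :=
  ∀ {Ω : Type u} (A B : Ω → Matrix (Fin n) (Fin n) F),
    Reach β M (fun ω l => (A ω l, B ω l)) fun ω => A ω * B ω

section Blocks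

variable {F m d s p : Type*}

/-- The matrix with entries `f` in the rows and columns given by `ρ`, and zeros elsewhere. -/
noncomputable def pad [Zero F] (ρ : m → p) (f : m × m → F) : Matrix p p F :=
  .of fun x y => Function.extend (Prod.map ρ ρ) f 0 (x, y)

lemma pad_apply [Zero F] {ρ : m → p} (hρ : Function.Injective ρ) (f : m × m → F) (i j : m) :
    pad ρ f (ρ i) (ρ j) = f (i, j) :=
  (hρ.prodMap hρ).extend_apply f 0 (i, j)

lemma pad_apply_of_left_notMem_range [Zero F] {ρ : m → p} (f : m × m → F) {x : p}
    (hx : x ∉ Set.range ρ) (y : p) : pad ρ f x y = 0 :=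
  Function.extend_apply' _ _ _ fun ⟨e, he⟩ => hx ⟨e.1, (Prod.ext_iff.1 he).1⟩

lemma pad_mul_pad_apply [NonUnitalNonAssocSemiring F] [Fintype m] [Fintype p] {ρ : m → p}
    (hρ : Function.Injective ρ) (A B : Matrix m m F) (i j : m) :
    (pad ρ (fun e => A e.1 e.2) * pad ρ fun e => B e.1 e.2) (ρ i) (ρ j) = (A * B) i j := by
  simp only [Matrix.mul_apply]
  refine (Fintype.sum_of_injective ρ hρ _ _ (fun x hx => ?_) fun x => ?_).symm
  · rw [pad_apply_of_left_notMem_range _ hx, mul_zero]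
  · rw [pad_apply hρ, pad_apply hρ]

/-- The linear combination, with coefficients `a`, of the `s × s` blocks of a matrix. -/
def blockComb [NonUnitalNonAssocSemiring F] [Fintype d] (a : Matrix d d F)
    (A : Matrix (d × s) (d × s) F) : Matrix s s F :=
  .of fun x y => ∑ i, ∑ j, a i j * A (i, x) (j, y)

lemma HasMatMulAlgorithm.exists_blockComb {F : Type u} [Field F] {d t : ℕ}
    (h : HasMatMulAlgorithm F d t) :
    ∃ (a b : Fin t → Matrix (Fin d) (Fin d) F) (c : Fin d → Fin d → Fin t → F),
      ∀ {s : ℕ} (A B : Matrix (Fin d × Fin s) (Fin d × Fin s) F) i j x y,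
        (A * B) (i, x) (j, y) = ∑ μ, c i j μ * (blockComb (a μ) A * blockComb (b μ) B) x y := by
  obtain ⟨α, γ, lam, h⟩ := h
  refine ⟨fun μ => .of fun i j => α i j μ, fun μ => .of fun i j => γ j i μ, lam,
    fun {s} A B i j x y => ?_⟩
  let block (A : Matrix (Fin d × Fin s) (Fin d × Fin s) F) (x y : Fin s) :
      Matrix (Fin d) (Fin d) F := .of fun i j => A (i, x) (j, y)
  calc (A * B) (i, x) (j, y) = ∑ z, (block A x z * block B z y) i j := by
        simp only [Matrix.mul_apply, Fintype.sum_prod_type_right, block, Matrix.of_apply]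
    _ = ∑ z, ∑ μ, lam i j μ * ((∑ i', ∑ j', α i' j' μ * block A x z i' j') *
          ∑ i', ∑ j', γ i' j' μ * block B z y j' i') := by simp only [h, mul_assoc]
    _ = ∑ μ, lam i j μ * ∑ z, (∑ i', ∑ j', α i' j' μ * block A x z i' j') *
          ∑ j', ∑ i', γ i' j' μ * block B z y j' i' := by
        rw [Finset.sum_comm]
        simp only [Finset.mul_sum, Finset.sum_comm (f := fun i' j' => γ i' j' _ * _)]
    _ = _ := by simp only [Matrix.mul_apply, blockComb, block, Matrix.of_apply]

lemma blockComb_pad_owned [NonUnitalNonAssocSemiring F] [Fintype d] {n : ℕ} {ρ : m → d × s}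
    (hρ : Function.Injective ρ) (pos : s × s → Fin n) (a : Matrix d d F) (f : m × m → F)
    (x : s × s) :
    blockComb a (pad ρ (owned (fun e => pos ((ρ e.1).2, (ρ e.2).2)) f (pos x))) x.1 x.2 =
      blockComb a (pad ρ f) x.1 x.2 := by
  simp only [blockComb, Matrix.of_apply]
  refine Finset.sum_congr rfl fun i _ => Finset.sum_congr rfl fun j _ => congrArg (a i j * ·) ?_
  by_cases hij : ∃ e, Prod.map ρ ρ e = ((i, x.1), (j, x.2))
  · obtain ⟨e, he⟩ := hij
    obtain ⟨hi, hj⟩ := Prod.ext_iff.1 he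
    change ρ e.1 = (i, x.1) at hi
    change ρ e.2 = (j, x.2) at hj
    rw [← hi, ← hj, pad_apply hρ, pad_apply hρ, owned, if_pos (by rw [hi, hj])]
  · exact (Function.extend_apply' _ _ _ hij).trans (Function.extend_apply' _ _ _ hij).symm

end Blocks

lemma card_filter_eq_le {X Y A : Type*} [Fintype X] [Fintype Y] [DecidableEq A] {f : X → A}
    (g : X → Y) (hfg : Function.Injective fun x => (f x, g x)) (a : A) :
    (Finset.univ.filter fun x => f x = a).card ≤ Fintype.card Y := by
  refine Finset.card_le_card_of_injOn g (fun _ _ => Finset.mem_coe.2 (Finset.mem_univ _)) ?_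
  intro x hx y hy hxy
  exact hfg (Prod.ext ((Finset.mem_filter_univ x).1 hx |>.trans
    ((Finset.mem_filter_univ y).1 hy).symm) hxy)

section BlockMul

variable {F : Type u} [Field F] [Finite F] {n β w d s t q : ℕ} {ρ : Fin n → Fin d × Fin s}

/-- The node that stores an entry of an `n × n` matrix cut into `s × s` blocks by `ρ`: it depends
only on the position in the block, and by `e` every node is responsible for at most `q`
positions. -/
def positionOwner (ρ : Fin n → Fin d × Fin s) (e : Fin s × Fin s ↪ Fin n × Fin q)
    (x : Fin n × Fin n) : Fin n :=
  (e ((ρ x.1).2, (ρ x.2).2)).1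

lemma card_positionOwner_le (hρ : Function.Injective ρ) (e : Fin s × Fin s ↪ Fin n × Fin q)
    (hqd : q * (d * d) ≤ n * 5) (l : Fin n) :
    (Finset.univ.filter fun x => positionOwner ρ e x = l).card ≤ n * 5 := by
  refine (card_filter_eq_le (Y := Fin q × Fin d × Fin d)
    (fun x => ((e ((ρ x.1).2, (ρ x.2).2)).2, (ρ x.1).1, (ρ x.2).1)) ?_ l).trans (by simpa using hqd)
  intro x y hxy
  simp only [positionOwner, Prod.mk.injEq] at hxy
  have hpos := Prod.ext_iff.1 (e.injective (Prod.ext hxy.1 hxy.2.1))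
  exact Prod.ext (hρ (Prod.ext hxy.2.2.1 hpos.1)) (hρ (Prod.ext hxy.2.2.2 hpos.2))

lemma card_fst_le (l : Fin n) :
    (Finset.univ.filter fun x : Fin n × Fin n => x.1 = l).card ≤ n * 5 :=
  (card_filter_eq_le Prod.snd Function.injective_id l).trans (by simp; omega)

lemma card_embedding_fst_le (e : Fin s × Fin s ↪ Fin n × Fin q) (ht : t ≤ n) (l : Fin n) :
    (Finset.univ.filter fun x : (Fin s × Fin s) × Fin t => (e x.1).1 = l).card ≤ n * q := by
  refine (card_filter_eq_le (fun x => ((e x.1).2, x.2)) ?_ l).trans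
    ((Fintype.card_prod _ _).trans_le ?_)
  · intro x y hxy
    simp only [Prod.mk.injEq] at hxy
    exact Prod.ext (e.injective (Prod.ext hxy.1 hxy.2.1)) hxy.2.2
  · simpa [mul_comm] using Nat.mul_le_mul_left q ht

lemma card_castLE_snd_le (e : Fin s × Fin s ↪ Fin n × Fin q) (ht : t ≤ n) (l : Fin n) :
    (Finset.univ.filter fun x : (Fin s × Fin s) × Fin t => Fin.castLE ht x.2 = l).card ≤ n * q := by
  refine (card_filter_eq_le (fun x => e x.1) ?_ l).trans (by simp)
  intro x y hxy
  simp only [Prod.mk.injEq] at hxy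
  exact Prod.ext (e.injective hxy.2) (Fin.castLE_injective ht hxy.1)

lemma Reach.blockComb (hF : FitsInMessages n β w F) (ht : t ≤ n) (hqd : q * (d * d) ≤ n * 5)
    (hρ : Function.Injective ρ) (e : Fin s × Fin s ↪ Fin n × Fin q)
    (a : Fin t → Matrix (Fin d) (Fin d) F) {Ω : Type*} (A : Ω → Matrix (Fin n) (Fin n) F) :
    Reach β (20 * w + 4 * q * w) A fun ω =>
      owned (fun x : (Fin s × Fin s) × Fin t => Fin.castLE ht x.2) fun x =>
        CongestedClique.blockComb (a x.2) (pad ρ fun e => A ω e.1 e.2) x.1.1 x.1.2 := by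
  have hentries : Reach β (4 * 5 * w) A fun ω =>
      owned (positionOwner ρ e) fun x => A ω x.1 x.2 := by
    refine (Reach.route hF card_fst_le (card_positionOwner_le hρ e hqd)
      fun ω x => A ω x.1 x.2).comap
      (fun l r x => if x.1 = l then r x.2 else 0) fun ω l => funext fun x => ?_
    simp only [owned]
    split_ifs with hx
    · rw [hx]
    · rfl
  have hcomb := hentries.map (Z := fun ω =>
      owned (fun x : (Fin s × Fin s) × Fin t => (e x.1).1) fun x =>
        CongestedClique.blockComb (a x.2) (pad ρ fun e => A ω e.1 e.2) x.1.1 x.1.2)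
    (fun l f x => if (e x.1).1 = l then
      CongestedClique.blockComb (a x.2) (pad ρ f) x.1.1 x.1.2 else 0) fun ω l => funext fun x => by
    rw [owned]
    split_ifs with hx
    · rw [← hx]
      exact (blockComb_pad_owned hρ (fun p => (e p).1) _ _ _).symm
    · rfl
  exact hcomb.trans (Reach.route hF (card_embedding_fst_le e ht) (card_castLE_snd_le e ht) _)

lemma Reach.blockComb_mul (hF : FitsInMessages n β w F) (ht : t ≤ n) (hqd : q * (d * d) ≤ n * 5)
    (hρ : Function.Injective ρ) (e : Fin s × Fin s ↪ Fin n × Fin q)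
    (a b : Fin t → Matrix (Fin d) (Fin d) F) {Ω : Type*} (A B : Ω → Matrix (Fin n) (Fin n) F) :
    Reach β (40 * w + 12 * q * w) (fun ω l => (A ω l, B ω l)) fun ω =>
      owned (fun x : (Fin s × Fin s) × Fin t => (e x.1).1) fun x =>
        (CongestedClique.blockComb (a x.2) (pad ρ fun e => A ω e.1 e.2) *
          CongestedClique.blockComb (b x.2) (pad ρ fun e => B ω e.1 e.2)) x.1.1 x.1.2 := by
  have hcombs := ((Reach.blockComb hF ht hqd hρ e a A).comap (X := fun ω l => (A ω l, B ω l))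
    (fun _ p => p.1) fun _ _ => rfl).prod ((Reach.blockComb hF ht hqd hρ e b B).comap
      (fun _ p => p.2) fun _ _ => rfl)
  have hmul := hcombs.map (Z := fun ω =>
      owned (fun x : (Fin s × Fin s) × Fin t => Fin.castLE ht x.2) fun x =>
      (CongestedClique.blockComb (a x.2) (pad ρ fun e => A ω e.1 e.2) *
        CongestedClique.blockComb (b x.2) (pad ρ fun e => B ω e.1 e.2)) x.1.1 x.1.2)
    (fun _ p x => ∑ z, p.1 ((x.1.1, z), x.2) * p.2 ((z, x.1.2), x.2)) fun ω l => funext fun x => by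
      by_cases hx : Fin.castLE ht x.2 = l <;> simp [owned, Matrix.mul_apply, hx]
  exact (hmul.trans (Reach.route hF (card_castLE_snd_le e ht) (card_embedding_fst_le e ht) _)).mono
    (le_of_eq (by ring))

lemma mulRounds_of_algorithm (hF : FitsInMessages n β w F) (h : HasMatMulAlgorithm F d t)
    (ht : t ≤ n) (hds : n ≤ d * s) (hs : s * s ≤ n * q) (hqd : q * (d * d) ≤ n * 5) :
    MulRounds n β F ((60 + 12 * q) * w) := by
  intro Ω A B
  obtain ⟨a, b, c, habc⟩ := h.exists_blockComb
  obtain ⟨ρ, hρ⟩ : Nonempty (Fin n ↪ Fin d × Fin s) :=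
    Function.Embedding.nonempty_of_card_le (by simpa using hds)
  obtain ⟨e⟩ : Nonempty (Fin s × Fin s ↪ Fin n × Fin q) :=
    Function.Embedding.nonempty_of_card_le (by simpa using hs)
  have hprod := (Reach.blockComb_mul hF ht hqd hρ e a b A B).map (Z := fun ω =>
      owned (positionOwner ρ e) fun x => (A ω * B ω) x.1 x.2)
    (fun l p x => if positionOwner ρ e x = l then
      ∑ μ, c (ρ x.1).1 (ρ x.2).1 μ * p (((ρ x.1).2, (ρ x.2).2), μ) else 0)
    fun ω l => funext fun x => by
      rw [owned]
      split_ifs with hx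
      · rw [← pad_mul_pad_apply hρ]
        exact (habc _ _ _ _ _ _).trans
          (Finset.sum_congr rfl fun μ _ => congrArg _ (if_pos hx).symm)
      · rfl
  have hrows := hprod.trans (Reach.route hF (card_positionOwner_le hρ e hqd) card_fst_le _)
  exact (hrows.map (fun l p j => p (l, j)) fun ω l => funext fun j => by simp [owned]).mono
    (le_of_eq (by ring))

end BlockMul

lemma exists_block_sizes {n d : ℕ} (hd : 1 ≤ d) (hdn : d * d ≤ n) :
    ∃ s q : ℕ, n ≤ d * s ∧ s * s ≤ n * q ∧ q * (d * d) ≤ n * 5 ∧ 1 ≤ q := by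
  have hn : 0 < n := by nlinarith
  set s := n / d + 1
  set q := s * s / n + 1
  have hs : n < d * s := Nat.lt_mul_div_succ n hd
  have hs' : s * d ≤ 2 * n := by
    have : n / d * d ≤ n := Nat.div_mul_le_self n d
    have : s * d = n / d * d + d := Nat.succ_mul _ _
    nlinarith
  have hq : s * s / n * (d * d) ≤ 4 * n := by
    refine Nat.le_of_mul_le_mul_left ?_ hn
    calc n * (s * s / n * (d * d)) = n * (s * s / n) * (d * d) := (mul_assoc _ _ _).symm
      _ ≤ s * s * (d * d) := Nat.mul_le_mul_right _ (Nat.mul_div_le _ _)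
      _ = (s * d) * (s * d) := by ring
      _ ≤ 2 * n * (2 * n) := Nat.mul_le_mul hs' hs'
      _ = n * (4 * n) := by ring
  refine ⟨s, q, hs.le, (Nat.lt_mul_div_succ (s * s) hn).le, ?_, Nat.le_add_left _ _⟩
  calc q * (d * d) = s * s / n * (d * d) + d * d := Nat.succ_mul _ _
    _ ≤ n * 5 := by omega

/-! ### The exponent of matrix multiplication -/

/-- The linear forms of the algorithm in the first factor separate matrices, since the second
factor may be the identity. -/
lemma HasMatMulAlgorithm.sq_le {F : Type u} [Field F] {m t : ℕ} (h : HasMatMulAlgorithm F m t) :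
    m * m ≤ t := by
  obtain ⟨α, γ, lam, h⟩ := h
  let f : Matrix (Fin m) (Fin m) F →ₗ[F] (Fin t → F) :=
    LinearMap.pi fun μ => ∑ i, ∑ j, α i j μ • Matrix.entryLinearMap F F i j
  have hf : Function.Injective f := by
    refine (injective_iff_map_eq_zero f).2 fun A hA => Matrix.ext fun i j => ?_
    have hforms (μ : Fin t) : ∑ i', ∑ j', α i' j' μ * A i' j' = 0 := by
      simpa [f, LinearMap.sum_apply] using congrFun hA μ
    simpa [hforms] using h A 1 i j
  simpa [Module.finrank_matrix] using LinearMap.finrank_le_finrank_of_injective hf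

lemma hasMatMulAlgorithm_cube (F : Type u) [Field F] (m : ℕ) :
    HasMatMulAlgorithm F m (m * (m * m)) := by
  let e : Fin (m * (m * m)) ≃ Fin m × Fin m × Fin m :=
    finProdFinEquiv.symm.trans (.prodCongr (.refl _) finProdFinEquiv.symm)
  refine ⟨fun i j μ => if (e μ).1 = i ∧ (e μ).2.1 = j then 1 else 0,
    fun i j μ => if (e μ).2.1 = j ∧ (e μ).2.2 = i then 1 else 0,
    fun i j μ => if (e μ).1 = i ∧ (e μ).2.2 = j then 1 else 0, fun A B i j => ?_⟩
  rw [← e.symm.sum_comp]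
  simp [Matrix.mul_apply, Fintype.sum_prod_type, ite_and]

section Exponent

variable {ι : Type v} {F : ι → Type u} [∀ i, Field (F i)]

lemma MatMulRankO.two_le [hι : Nonempty ι] {τ : ℝ} (h : MatMulRankO F τ) : 2 ≤ τ := by
  obtain ⟨C, h⟩ := h
  obtain ⟨i⟩ := hι
  by_contra! hτ
  have hbounded (m : ℕ) (hm : 1 ≤ m) : (m : ℝ) ^ (2 - τ) ≤ C := by
    obtain ⟨t, ht, ha⟩ := h i m hm
    have hm0 : (0 : ℝ) < m := by exact_mod_cast hm
    rw [Real.rpow_sub hm0, div_le_iff₀ (Real.rpow_pos_of_pos hm0 _)]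
    calc (m : ℝ) ^ (2 : ℝ) = ((m * m : ℕ) : ℝ) := by norm_cast; ring
      _ ≤ t := by exact_mod_cast ha.sq_le
      _ ≤ C * (m : ℝ) ^ τ := ht
  have htop := (tendsto_rpow_atTop (sub_pos.2 hτ)).comp tendsto_natCast_atTop_atTop
  obtain ⟨m, hm, hm1⟩ := ((htop.eventually_gt_atTop C).and
    (Filter.eventually_ge_atTop 1)).exists
  exact (hbounded m hm1).not_gt hm

lemma matMulRankO_three : MatMulRankO F 3 := by
  refine ⟨1, fun i m _ => ⟨_, le_of_eq ?_, hasMatMulAlgorithm_cube (F i) m⟩⟩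
  norm_cast
  ring

lemma MatMulRankO.mono {τ τ' : ℝ} (h : MatMulRankO F τ) (hτ : τ ≤ τ') : MatMulRankO F τ' := by
  obtain ⟨C, h⟩ := h
  refine ⟨max C 0, fun i m hm => ?_⟩
  obtain ⟨t, ht, ha⟩ := h i m hm
  have hm1 : (1 : ℝ) ≤ m := by exact_mod_cast hm
  refine ⟨t, ht.trans ?_, ha⟩
  calc C * (m : ℝ) ^ τ ≤ max C 0 * (m : ℝ) ^ τ := by gcongr; exact le_max_left _ _
    _ ≤ max C 0 * (m : ℝ) ^ τ' := by gcongr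

lemma two_le_matMulExponent [Nonempty ι] : 2 ≤ matMulExponent F :=
  le_csInf ⟨3, fun _ hε => matMulRankO_three.mono (by linarith)⟩
    fun _ hτ => le_of_forall_pos_le_add fun ε hε => (hτ ε hε).two_le

lemma matMulRankO_matMulExponent_add {ε : ℝ} (hε : 0 < ε) :
    MatMulRankO F (matMulExponent F + ε) := by
  have hne : {τ : ℝ | ∀ δ : ℝ, 0 < δ → MatMulRankO F (τ + δ)}.Nonempty :=
    ⟨3, fun _ hδ => matMulRankO_three.mono (by linarith)⟩
  obtain ⟨τ, hτ, hlt⟩ := Real.lt_sInf_add_pos hne hε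
  change τ < matMulExponent F + ε at hlt
  exact (hτ (matMulExponent F + ε - τ) (by linarith)).mono (by linarith)

lemma one_sub_two_div_add_le {ω ε : ℝ} (hω : 2 ≤ ω) (hε : 0 ≤ ε) :
    1 - 2 / (ω + ε) ≤ 1 - 2 / ω + ε := by
  have hdiff : 2 / ω - 2 / (ω + ε) = ε * (2 / (ω * (ω + ε))) := by
    field_simp
    ring
  have hle : 2 / (ω * (ω + ε)) ≤ 1 := div_le_one_of_le₀ (by nlinarith) (by positivity)
  linarith [mul_le_of_le_one_right hε hle]

lemma exists_nat_mul_rpow_le {C τ x : ℝ} (hC : 0 < C) (hτ : 0 < τ) (hx : C ≤ x) :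
    ∃ m : ℕ, 1 ≤ m ∧ C * (m : ℝ) ^ τ ≤ x ∧ x ^ (2 / τ) ≤ 4 * C ^ (2 / τ) * (m : ℝ) ^ 2 := by
  set y := (x / C) ^ (1 / τ) with hy
  have hxC : 1 ≤ x / C := (one_le_div hC).2 hx
  have hy1 : 1 ≤ y := Real.one_le_rpow hxC (by positivity)
  have hy0 : 0 ≤ y := by linarith
  have hfloor : 1 ≤ ⌊y⌋₊ := Nat.one_le_floor_iff _ |>.2 hy1
  have hy_le : y ≤ 2 * ⌊y⌋₊ := by
    have : (1 : ℝ) ≤ ⌊y⌋₊ := by exact_mod_cast hfloor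
    linarith [Nat.lt_floor_add_one y]
  refine ⟨⌊y⌋₊, hfloor, ?_, ?_⟩
  · calc C * (⌊y⌋₊ : ℝ) ^ τ ≤ C * y ^ τ := by gcongr; exact Nat.floor_le hy0
      _ = x := by
        rw [hy, ← Real.rpow_mul (by positivity), one_div_mul_cancel hτ.ne', Real.rpow_one,
          mul_div_cancel₀ _ hC.ne']
  · have hysq : (x / C) ^ (2 / τ) = y ^ 2 := by
      rw [hy, ← Real.rpow_mul_natCast (by positivity), Nat.cast_ofNat, one_div_mul_eq_div]
    calc x ^ (2 / τ) = C ^ (2 / τ) * (x / C) ^ (2 / τ) := by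
          rw [← Real.mul_rpow hC.le (by positivity), mul_div_cancel₀ _ hC.ne']
      _ = C ^ (2 / τ) * y ^ 2 := by rw [hysq]
      _ ≤ C ^ (2 / τ) * (2 * ⌊y⌋₊) ^ 2 := by gcongr
      _ = 4 * C ^ (2 / τ) * (⌊y⌋₊ : ℝ) ^ 2 := by ring

lemma MatMulRankO.exists_size {τ : ℝ} (h : MatMulRankO F τ) (hτ : 0 < τ) :
    ∃ C : ℝ, ∀ (i : ι) (n : ℕ), 1 ≤ n → ∃ d t : ℕ, HasMatMulAlgorithm (F i) d t ∧
      1 ≤ d ∧ t ≤ n ∧ (n : ℝ) ^ (2 / τ) ≤ C * (d : ℝ) ^ 2 := by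
  obtain ⟨C, h⟩ := h
  set C₁ := max C 1
  have hC₁ : 0 < C₁ := lt_max_of_lt_right one_pos
  have hpos : 0 < C₁ ^ (2 / τ) := Real.rpow_pos_of_pos hC₁ _
  refine ⟨4 * C₁ ^ (2 / τ), fun i n hn => ?_⟩
  rcases lt_or_ge (n : ℝ) C₁ with hlt | hge
  · refine ⟨1, 1, hasMatMulAlgorithm_cube (F i) 1, le_rfl, hn, ?_⟩
    calc (n : ℝ) ^ (2 / τ) ≤ C₁ ^ (2 / τ) := by gcongr
      _ ≤ 4 * C₁ ^ (2 / τ) * ((1 : ℕ) : ℝ) ^ 2 := by norm_num; linarith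
  · obtain ⟨d, hd, hdn, hdC⟩ := exists_nat_mul_rpow_le hC₁ hτ hge
    obtain ⟨t, ht, ha⟩ := h i d hd
    refine ⟨d, t, ha, hd, ?_, hdC⟩
    have htn : (t : ℝ) ≤ n := calc
      (t : ℝ) ≤ C * (d : ℝ) ^ τ := ht
      _ ≤ C₁ * (d : ℝ) ^ τ := by gcongr; exact le_max_left _ _
      _ ≤ n := hdn
    exact_mod_cast htn

lemma MatMulRankO.exists_mulRounds [∀ i, Finite (F i)] {τ : ℝ} (h : MatMulRankO F τ)
    (hτ : 0 < τ) (β w : ℕ) : ∃ C : ℝ, ∀ (i : ι) (n : ℕ), 1 ≤ n → FitsInMessages n β w (F i) →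
      ∃ M : ℕ, w ≤ M ∧ (M : ℝ) ≤ C * (n : ℝ) ^ (1 - 2 / τ) ∧ MulRounds n β (F i) M := by
  obtain ⟨C, h⟩ := h.exists_size hτ
  refine ⟨360 * w * C, fun i n hn hF => ?_⟩
  obtain ⟨d, t, ha, hd, ht, hdn⟩ := h i n hn
  obtain ⟨s, q, hds, hs, hqd, hq⟩ := exists_block_sizes hd (ha.sq_le.trans ht)
  have hn0 : (0 : ℝ) < n := by exact_mod_cast hn
  have hqn : (q : ℝ) ≤ 5 * C * (n : ℝ) ^ (1 - 2 / τ) := by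
    have hqd' : (q : ℝ) * (d : ℝ) ^ 2 ≤ n * 5 := by exact_mod_cast (sq d).symm ▸ hqd
    refine le_of_mul_le_mul_right ?_ (by positivity : 0 < (d : ℝ) ^ 2)
    calc (q : ℝ) * (d : ℝ) ^ 2 ≤ 5 * ((n : ℝ) ^ (1 - 2 / τ) * (n : ℝ) ^ (2 / τ)) := by
          rwa [← Real.rpow_add hn0, sub_add_cancel, Real.rpow_one, mul_comm 5]
      _ ≤ 5 * ((n : ℝ) ^ (1 - 2 / τ) * (C * (d : ℝ) ^ 2)) := by gcongr
      _ = 5 * C * (n : ℝ) ^ (1 - 2 / τ) * (d : ℝ) ^ 2 := by ring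
  refine ⟨(60 + 12 * q) * w, by nlinarith, ?_, mulRounds_of_algorithm hF ha ht hds hs hqd⟩
  calc (((60 + 12 * q) * w : ℕ) : ℝ) ≤ ((72 * w * q : ℕ) : ℝ) := by
        exact_mod_cast (by nlinarith [Nat.mul_le_mul_left w hq])
    _ = 72 * w * (q : ℝ) := by push_cast; rfl
    _ ≤ 72 * w * (5 * C * (n : ℝ) ^ (1 - 2 / τ)) := by gcongr
    _ = 360 * w * C * (n : ℝ) ^ (1 - 2 / τ) := by ring

end Exponent

/-! ### Krylov sequences and Hankel matrices -/

section Krylov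

open Matrix

variable {m R S : Type*} [Fintype m] [DecidableEq m] [CommRing R] [CommRing S]

/-- The sequence `uᵀ v, uᵀ B v, uᵀ B² v, …` on which Wiedemann's method is based. -/
def moment (B : Matrix m m R) (u v : m → R) (j : ℕ) : R :=
  u ⬝ᵥ (B ^ j *ᵥ v)

/-- The Hankel matrix of order `r` of the sequence `s` shifted by `c`. -/
def hankel (r : ℕ) (s : ℕ → R) (c : ℕ) : Matrix (Fin r) (Fin r) R :=
  .of fun i j => s (i + j + c)

/-- The matrix with the rows `uᵀ, uᵀ B, …, uᵀ Bʳ⁻¹`. -/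
def krylovRows (r : ℕ) (B : Matrix m m R) (u : m → R) : Matrix (Fin r) m R :=
  .of fun i => u ᵥ* B ^ (i : ℕ)

/-- The matrix with the columns `v, B v, …, Bʳ⁻¹ v`. -/
def krylovCols (r : ℕ) (B : Matrix m m R) (v : m → R) : Matrix m (Fin r) R :=
  .of fun l j => (B ^ (j : ℕ) *ᵥ v) l

lemma moment_pow_mulVec (B : Matrix m m R) (u v : m → R) (i j : ℕ) :
    moment B u (B ^ i *ᵥ v) j = moment B u v (j + i) := by
  rw [moment, moment, mulVec_mulVec, pow_add]

lemma krylovRows_mulVec (r : ℕ) (B : Matrix m m R) (u v : m → R) :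
    krylovRows r B u *ᵥ v = fun i : Fin r => moment B u v i :=
  funext fun i => (dotProduct_mulVec u (B ^ (i : ℕ)) v).symm

lemma hankel_moment (r : ℕ) (B : Matrix m m R) (u v : m → R) (c : ℕ) :
    hankel r (moment B u v) c = krylovRows r B u * B ^ c * krylovCols r B v := by
  ext i j
  calc moment B u v (i + j + c)
      = u ⬝ᵥ (B ^ (i : ℕ) *ᵥ B ^ c *ᵥ B ^ (j : ℕ) *ᵥ v) := by
        rw [moment, mulVec_mulVec, mulVec_mulVec, ← pow_add, ← pow_add, add_right_comm, add_assoc]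
    _ = (krylovRows r B u * B ^ c * krylovCols r B v) i j := by
        rw [dotProduct_mulVec, dotProduct_mulVec]
        rfl

lemma map_moment (f : R →+* S) (B : Matrix m m R) (u v : m → R) (j : ℕ) :
    f (moment B u v j) = moment (B.map f) (f ∘ u) (f ∘ v) j := by
  have hpow : B.map f ^ j = (B ^ j).map f := (map_pow f.mapMatrix B j).symm
  have hmul : f ∘ (B ^ j *ᵥ v) = (B ^ j).map f *ᵥ (f ∘ v) := funext (f.map_mulVec _ _)
  rw [moment, moment, hpow, f.map_dotProduct, hmul]

lemma map_det_hankel_moment (f : R →+* S) (r : ℕ) (B : Matrix m m R) (u v : m → R) (c : ℕ) :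
    f (hankel r (moment B u v) c).det =
      (hankel r (moment (B.map f) (f ∘ u) (f ∘ v)) c).det := by
  rw [f.map_det]
  congr 1
  ext i j
  exact map_moment f B u v _

end Krylov

section Wiedemann

open Matrix

variable {F : Type*} [Field F] {n : ℕ} {A B U : Matrix (Fin n) (Fin n) F} {u v b : Fin n → F}

lemma det_ne_zero_of_det_hankel_ne_zero (h : (hankel n (moment B u v) 1).det ≠ 0) :
    (krylovRows n B u).det ≠ 0 ∧ B.det ≠ 0 ∧ (krylovCols n B v).det ≠ 0 := by
  rw [hankel_moment, pow_one, det_mul, det_mul] at h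
  simpa [and_assoc] using h

lemma det_hankel_div (h : B.det ≠ 0 → (hankel n (moment B u v) 1).det ≠ 0) :
    (hankel n (moment B u v) 1).det / (hankel n (moment B u v) 0).det = B.det := by
  by_cases hB : B.det = 0
  · rw [hankel_moment, pow_one, det_mul, det_mul, hB, mul_zero, zero_mul, zero_div]
  · obtain ⟨hu, -, hv⟩ := det_ne_zero_of_det_hankel_ne_zero (h hB)
    rw [hankel_moment, hankel_moment, pow_one, pow_zero, mul_one, det_mul, det_mul, det_mul]
    field_simp

lemma det_hankel_div_div (hA : IsUnit A → (hankel n (moment (A * U) u v) 1).det ≠ 0)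
    (hU : (hankel n (moment U u v) 1).det ≠ 0) :
    (hankel n (moment (A * U) u v) 1).det / (hankel n (moment (A * U) u v) 0).det /
      ((hankel n (moment U u v) 1).det / (hankel n (moment U u v) 0).det) = A.det := by
  have hAU : (A * U).det ≠ 0 → (hankel n (moment (A * U) u v) 1).det ≠ 0 := fun h =>
    hA <| (isUnit_iff_isUnit_det A).2 (left_ne_zero_of_mul (det_mul A U ▸ h)).isUnit
  rw [det_hankel_div hAU, det_hankel_div fun _ => hU, det_mul,
    mul_div_cancel_right₀ _ (det_ne_zero_of_det_hankel_ne_zero hU).2.1]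

lemma rank_hankel_of_det_ne_zero (h : (hankel A.rank (moment (A * U) u v) 1).det ≠ 0) :
    (hankel n (moment (A * U) u v) 1).rank = A.rank := by
  have hrank : A.rank ≤ n := A.rank_le_height
  apply le_antisymm
  · rw [hankel_moment, pow_one]
    exact (rank_mul_le_left _ _).trans ((rank_mul_le_right _ _).trans (rank_mul_le_left _ _))
  · calc A.rank = (hankel A.rank (moment (A * U) u v) 1).rank := by
          rw [rank_of_isUnit _ ((isUnit_iff_isUnit_det _).2 h.isUnit), Fintype.card_fin]
      _ = ((hankel n (moment (A * U) u v) 1).submatrix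
            (Fin.castLE hrank) (Fin.castLE hrank)).rank := rfl
      _ ≤ _ := rank_submatrix_le _ _ _

lemma mulVec_krylovCols_hankel_inv (h : b ≠ 0 → (hankel n (moment B u b) 1).det ≠ 0) :
    B *ᵥ krylovCols n B b *ᵥ (hankel n (moment B u b) 1)⁻¹ *ᵥ
      (fun i : Fin n => moment B u b i) = b := by
  obtain rfl | hb := eq_or_ne b 0
  · have hmoment : (fun i : Fin n => moment B u 0 i) = 0 := funext fun i => by simp [moment]
    simp only [hmoment, mulVec_zero]
  · have hu := (det_ne_zero_of_det_hankel_ne_zero (h hb)).1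
    apply mulVec_injective_of_isUnit ((isUnit_iff_isUnit_det _).2 hu.isUnit)
    have hfactor := hankel_moment n B u b 1
    rw [pow_one] at hfactor
    rw [mulVec_mulVec, mulVec_mulVec, ← hfactor, mulVec_mulVec, mul_nonsing_inv _ (h hb).isUnit,
      one_mulVec, krylovRows_mulVec]

end Wiedemann

/-! ### Nonvanishing of the Hankel determinants -/

section Cyclic

open Matrix
open scoped Fin.NatCast

variable {F : Type*} [Field F]

lemma det_hankel_ite_dvd_ne_zero (k : ℕ) :
    (hankel (k + 1) (fun j => if k + 1 ∣ j then (1 : F) else 0) 1).det ≠ 0 := by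
  have hperm : hankel (k + 1) (fun j => if k + 1 ∣ j then (1 : F) else 0) 1 =
      Fin.revPerm.permMatrix F := by
    ext i j
    have hdvd : k + 1 ∣ (i + j + 1 : ℕ) ↔ i.rev = j := by
      rw [Fin.ext_iff, Fin.val_rev]
      refine ⟨fun h => ?_, fun h => ⟨1, by omega⟩⟩
      have := Nat.eq_of_dvd_of_lt_two_mul (by omega) h (by omega)
      omega
    simp [hankel, hdvd, PEquiv.toMatrix_apply]
  rw [hperm, det_permutation]
  rcases Int.units_eq_one_or (Equiv.Perm.sign (Fin.revPerm (n := k + 1))) with h | h <;> simp [h]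

lemma exists_linearIndependent_zero_eq {V : Type*} [AddCommGroup V] [Module F V] {b : V}
    (hb : b ≠ 0) {k : ℕ} (hk : k < Module.finrank F V) :
    ∃ p : Fin (k + 1) → V, LinearIndependent F p ∧ p 0 = b := by
  induction k with
  | zero => exact ⟨fun _ => b, by simpa using hb, rfl⟩
  | succ k ih =>
    obtain ⟨p, hp, hp0⟩ := ih (by omega)
    obtain ⟨x, hx⟩ := exists_linearIndependent_snoc_of_lt_finrank hp hk
    exact ⟨_, hx, by rw [Fin.snoc_apply_zero, hp0]⟩

lemma exists_linearMap_apply_eq {V W I : Type*} [AddCommGroup V] [Module F V] [AddCommGroup W]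
    [Module F W] {p : I → V} (hp : LinearIndependent F p) (y : I → W) :
    ∃ f : V →ₗ[F] W, ∀ i, f (p i) = y i := by
  obtain ⟨g, hg⟩ := (Finsupp.linearCombination F p).exists_leftInverse_of_injective
    (LinearMap.ker_eq_bot.2 hp)
  refine ⟨Finsupp.linearCombination F y ∘ₗ g, fun i => ?_⟩
  have hgp : g (p i) = Finsupp.single i 1 := by
    simpa using LinearMap.congr_fun hg (Finsupp.single i 1)
  rw [LinearMap.comp_apply, hgp, Finsupp.linearCombination_single, one_smul]

variable {n : ℕ}

lemma exists_pow_mulVec_eq_cyclic (A : Matrix (Fin n) (Fin n) F) {k : ℕ}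
    {p : Fin (k + 1) → Fin n → F} (hp : LinearIndependent F p)
    (hpA : ∀ i, p i ∈ LinearMap.range A.mulVecLin) :
    ∃ U : Matrix (Fin n) (Fin n) F, ∀ j : ℕ, (A * U) ^ j *ᵥ p 0 = p j := by
  choose x hx using hpA
  obtain ⟨f, hf⟩ := exists_linearMap_apply_eq hp fun i => x (i + 1)
  refine ⟨f.toMatrix', fun j => ?_⟩
  induction j with
  | zero => simp
  | succ j ih =>
    rw [pow_succ', ← mulVec_mulVec, ih, ← mulVec_mulVec, LinearMap.toMatrix'_mulVec, hf,
      Nat.cast_succ]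
    exact hx _

lemma exists_det_hankel_moment_ne_zero (A : Matrix (Fin n) (Fin n) F) {b : Fin n → F}
    (hb : b ≠ 0) (hbA : b ∈ LinearMap.range A.mulVecLin) :
    ∃ U u, (hankel A.rank (moment (A * U) u b) 1).det ≠ 0 := by
  let b' : LinearMap.range A.mulVecLin := ⟨b, hbA⟩
  have hb' : b' ≠ 0 := fun h => hb (congrArg Subtype.val h)
  have : Nontrivial (LinearMap.range A.mulVecLin) := ⟨b', 0, hb'⟩
  obtain ⟨k, hk⟩ := Nat.exists_eq_succ_of_ne_zero (Module.finrank_pos (R := F)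
    (M := LinearMap.range A.mulVecLin)).ne'
  obtain ⟨p, hp, hp0⟩ := exists_linearIndependent_zero_eq hb' (hk.symm ▸ k.lt_succ_self)
  have hp' : LinearIndependent F fun i => (p i : Fin n → F) :=
    hp.map' (Submodule.subtype _) (Submodule.ker_subtype _)
  obtain ⟨U, hU⟩ := exists_pow_mulVec_eq_cyclic A hp' fun i => (p i).2
  obtain ⟨φ, hφ⟩ := exists_linearMap_apply_eq hp' (Pi.single 0 (1 : F))
  refine ⟨U, (dotProductEquiv F (Fin n)).symm φ, ?_⟩
  have hmoment (j : ℕ) : moment (A * U) ((dotProductEquiv F (Fin n)).symm φ) b j =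
      if k + 1 ∣ j then 1 else 0 := by
    have hpow : (A * U) ^ j *ᵥ b = p j := by simpa only [hp0] using hU j
    calc moment (A * U) ((dotProductEquiv F (Fin n)).symm φ) b j
        = dotProductEquiv F (Fin n) ((dotProductEquiv F (Fin n)).symm φ) (p j) := by
          rw [moment, hpow, dotProductEquiv_apply_apply]
      _ = if k + 1 ∣ j then 1 else 0 := by
          rw [LinearEquiv.apply_symm_apply, hφ, Pi.single_apply]
          simp only [Fin.natCast_eq_zero]
  have hrank : A.rank = k + 1 := hk
  rw [hrank, funext hmoment]
  exact det_hankel_ite_dvd_ne_zero k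

end Cyclic

/-! ### Failure probabilities -/

section UniformProb

variable {α α' : Type*}

lemma uniformProb_empty : uniformProb (∅ : Set α) = 0 := by
  rw [uniformProb, Set.ncard_empty, Nat.cast_zero, zero_div]

lemma uniformProb_mono [Finite α] {s t : Set α} (h : s ⊆ t) : uniformProb s ≤ uniformProb t := by
  unfold uniformProb
  gcongr
  exact t.toFinite

lemma uniformProb_union_le (s t : Set α) : uniformProb (s ∪ t) ≤ uniformProb s + uniformProb t := by
  unfold uniformProb
  rw [← add_div]
  gcongr
  exact_mod_cast Set.ncard_union_le s t

lemma uniformProb_and_le {p : Prop} {s : α → Prop} {δ : ℝ} (hδ : 0 ≤ δ)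
    (h : p → uniformProb {x | s x} ≤ δ) : uniformProb {x | p ∧ s x} ≤ δ := by
  by_cases hp : p
  · simpa only [hp, true_and] using h hp
  · simpa only [hp, false_and, Set.ofPred_false, uniformProb_empty] using hδ

lemma uniformProb_preimage_equiv (f : α ≃ α') (s : Set α') :
    uniformProb (f ⁻¹' s) = uniformProb s := by
  rw [uniformProb, uniformProb, Nat.card_congr f,
    Set.ncard_preimage_of_injective_subset_range f.injective (by simp)]

end UniformProb

section Polynomial

open Matrix MvPolynomial

variable {m σ F : Type*} [Field F]

lemma uniformProb_eval_eq_zero_le [Finite F] [Finite σ] {p : MvPolynomial σ F} (hp : p ≠ 0) :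
    uniformProb {x | eval x p = 0} ≤ p.totalDegree / Nat.card F := by
  classical
  have := Fintype.ofFinite F
  have := Fintype.ofFinite σ
  let e := Fintype.equivFin σ
  have hpre : {x : σ → F | eval x p = 0} =
      Equiv.arrowCongr e (Equiv.refl F) ⁻¹' {y | eval y (rename e p) = 0} := by
    ext x
    simp [eval_rename, Function.comp_def]
  have hsz := schwartz_zippel_totalDegree (p := rename e p)
    (by rwa [Ne, map_eq_zero_iff _ (rename_injective e e.injective)]) (Finset.univ : Finset F)
  have hdeg : (rename e p).totalDegree = p.totalDegree := totalDegree_renameEquiv e p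
  have hsz' := (NNRat.cast_le (K := ℝ)).2 hsz
  rw [hpre, ← hdeg, uniformProb_preimage_equiv, uniformProb, Set.ncard_eq_toFinset_card']
  simpa using hsz'

lemma totalDegree_dotProduct_le [Fintype m] {u v : m → MvPolynomial σ F} {a b : ℕ}
    (hu : ∀ i, (u i).totalDegree ≤ a) (hv : ∀ i, (v i).totalDegree ≤ b) :
    (u ⬝ᵥ v).totalDegree ≤ a + b :=
  totalDegree_finsetSum_le fun i _ => (totalDegree_mul _ _).trans (add_le_add (hu i) (hv i))

lemma totalDegree_det_le {r d : ℕ} {M : Matrix (Fin r) (Fin r) (MvPolynomial σ F)}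
    (hM : ∀ i j, (M i j).totalDegree ≤ d) : M.det.totalDegree ≤ r * d := by
  rw [det_apply]
  refine totalDegree_finsetSum_le fun p _ => (totalDegree_smul_le _ _).trans ?_
  calc (∏ i, M (p i) i).totalDegree ≤ ∑ i, (M (p i) i).totalDegree := totalDegree_finsetProd _ _
    _ ≤ ∑ _ : Fin r, d := Finset.sum_le_sum fun i _ => hM (p i) i
    _ = r * d := by simp

variable [Fintype m] [DecidableEq m] {B : Matrix m m (MvPolynomial σ F)}
  {u v : m → MvPolynomial σ F}

lemma totalDegree_moment_le (hB : ∀ i j, (B i j).totalDegree ≤ 1)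
    (hu : ∀ i, (u i).totalDegree ≤ 1) (hv : ∀ i, (v i).totalDegree ≤ 1) (j : ℕ) :
    (moment B u v j).totalDegree ≤ j + 2 := by
  have hpow (j : ℕ) : ∀ i, ((B ^ j *ᵥ v) i).totalDegree ≤ j + 1 := by
    induction j with
    | zero => simpa using hv
    | succ j ih =>
      intro i
      rw [pow_succ', ← mulVec_mulVec]
      exact (totalDegree_dotProduct_le (hB i) ih).trans (by omega)
  exact (totalDegree_dotProduct_le hu (hpow j)).trans (by omega)

lemma totalDegree_det_hankel_moment_le (hB : ∀ i j, (B i j).totalDegree ≤ 1)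
    (hu : ∀ i, (u i).totalDegree ≤ 1) (hv : ∀ i, (v i).totalDegree ≤ 1) (r : ℕ) :
    (hankel r (moment B u v) 1).det.totalDegree ≤ 3 * r ^ 2 := by
  have hentry (i j : Fin r) : (hankel r (moment B u v) 1 i j).totalDegree ≤ 2 * r + 1 :=
    (totalDegree_moment_le hB hu hv _).trans (by omega)
  exact (totalDegree_det_le hentry).trans (by nlinarith [Nat.le_mul_self r])

lemma uniformProb_det_hankel_moment_eq_zero_le [Finite F] [Finite σ]
    (hB : ∀ i j, (B i j).totalDegree ≤ 1) (hu : ∀ i, (u i).totalDegree ≤ 1)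
    (hv : ∀ i, (v i).totalDegree ≤ 1) {r : ℕ}
    (hne : ∃ x : σ → F,
      (hankel r (moment (B.map (eval x)) (eval x ∘ u) (eval x ∘ v)) 1).det ≠ 0) :
    uniformProb {x : σ → F |
      (hankel r (moment (B.map (eval x)) (eval x ∘ u) (eval x ∘ v)) 1).det = 0} ≤
        3 * (r : ℝ) ^ 2 / Nat.card F := by
  simp only [← map_det_hankel_moment] at hne ⊢
  obtain ⟨x, hx⟩ := hne
  refine (uniformProb_eval_eq_zero_le (ne_zero_of_map hx)).trans ?_
  gcongr
  exact_mod_cast totalDegree_det_hankel_moment_le hB hu hv r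

end Polynomial

section Coins

open Matrix MvPolynomial

variable {n : ℕ} {F : Type*}

/-- The coins of one node in Wiedemann's algorithm: its row of a random matrix and its entries of
two random vectors. -/
abbrev WiedemannCoin (n : ℕ) (F : Type*) : Type _ := (Fin n → F) × F × F

/-- The random preconditioner `U`, whose rows are chosen by the nodes. -/
def coinMatrix (x : Fin n → WiedemannCoin n F) : Matrix (Fin n) (Fin n) F := .of fun i => (x i).1

/-- The random vector `u` of linear functionals. -/
def coinLeft (x : Fin n → WiedemannCoin n F) (i : Fin n) : F := (x i).2.1

/-- The random starting vector `v` of the Krylov sequence. -/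
def coinRight (x : Fin n → WiedemannCoin n F) (i : Fin n) : F := (x i).2.2

/-- All coins, listed as a single family of field elements, so that the Schwartz–Zippel lemma
applies. -/
def coinEquiv (n : ℕ) (F : Type*) :
    (Fin n × (Fin n ⊕ Fin 2) → F) ≃ (Fin n → WiedemannCoin n F) :=
  (Equiv.curry _ _ _).trans <| Equiv.piCongrRight fun _ =>
    (Equiv.sumArrowEquivProdArrow _ _ _).trans ((Equiv.refl _).prodCongr (finTwoArrowEquiv F))

variable [Field F] [Finite F]

lemma uniformProb_det_hankel_coins_eq_zero_le (A : Matrix (Fin n) (Fin n) F)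
    {v : (Fin n → WiedemannCoin n F) → Fin n → F}
    {p : Fin n → MvPolynomial (Fin n × (Fin n ⊕ Fin 2)) F} (hp : ∀ i, (p i).totalDegree ≤ 1)
    (hv : ∀ x i, v (coinEquiv n F x) i = eval x (p i)) {r : ℕ} (hr : r ≤ n)
    (hne : ∃ x, (hankel r (moment (A * coinMatrix x) (coinLeft x) (v x)) 1).det ≠ 0) :
    uniformProb {x | (hankel r (moment (A * coinMatrix x) (coinLeft x) (v x)) 1).det = 0} ≤
      3 * (n : ℝ) ^ 2 / Nat.card F := by
  let B : Matrix (Fin n) (Fin n) (MvPolynomial (Fin n × (Fin n ⊕ Fin 2)) F) :=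
    A.map C * .of fun i j => X (i, .inl j)
  let u (i : Fin n) : MvPolynomial (Fin n × (Fin n ⊕ Fin 2)) F := X (i, .inr 0)
  have hB (i j) : (B i j).totalDegree ≤ 1 :=
    (totalDegree_dotProduct_le (a := 0) (b := 1) (fun k => by simp) fun k => by simp)
  have hu (i) : (u i).totalDegree ≤ 1 := by simp [u]
  have hBx (x) : B.map (eval x) = A * coinMatrix (coinEquiv n F x) := by
    ext i j
    simp [B, mul_apply, coinMatrix, coinEquiv]
  have hux (x) : eval x ∘ u = coinLeft (coinEquiv n F x) := funext fun i => by
    simp [u, coinLeft, coinEquiv]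
  have hvx (x) : eval x ∘ p = v (coinEquiv n F x) := funext fun i => (hv x i).symm
  have hbound := uniformProb_det_hankel_moment_eq_zero_le hB hu hp (r := r)
  simp only [hBx, hux, hvx] at hbound
  rw [← uniformProb_preimage_equiv (coinEquiv n F)]
  refine (hbound ((coinEquiv n F).surjective.exists.1 hne)).trans ?_
  gcongr

lemma uniformProb_det_hankel_eq_zero_le_of_isUnit {A : Matrix (Fin n) (Fin n) F} (hA : IsUnit A)
    {b : Fin n → F} (hb : b ≠ 0) :
    uniformProb {x | (hankel n (moment (A * coinMatrix x) (coinLeft x) b) 1).det = 0} ≤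
      3 * (n : ℝ) ^ 2 / Nat.card F := by
  obtain ⟨U, u, h⟩ := exists_det_hankel_moment_ne_zero A hb
    ((mulVec_surjective_iff_isUnit.2 hA) b)
  rw [rank_of_isUnit A hA, Fintype.card_fin] at h
  exact uniformProb_det_hankel_coins_eq_zero_le A (v := fun _ => b) (p := fun i => C (b i))
    (fun i => by simp) (fun x i => by simp) le_rfl ⟨fun i => (U i, u i, 0), h⟩

lemma uniformProb_det_hankel_eq_zero_le_of_rank {A : Matrix (Fin n) (Fin n) F} {r : ℕ}
    (hr : A.rank = r) :
    uniformProb {x | (hankel r (moment (A * coinMatrix x) (coinLeft x) (coinRight x)) 1).det = 0} ≤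
      3 * (n : ℝ) ^ 2 / Nat.card F := by
  refine uniformProb_det_hankel_coins_eq_zero_le A (p := fun i => X (i, .inr 1)) (fun i => by simp)
    (fun x i => by simp [coinRight, coinEquiv]) (hr ▸ A.rank_le_height) ?_
  obtain rfl | hA := eq_or_ne A 0
  · rw [rank_zero] at hr
    subst hr
    exact ⟨fun _ => 0, by rw [det_isEmpty]; exact one_ne_zero⟩
  · obtain ⟨y, hy⟩ : ∃ y, A *ᵥ y ≠ 0 := by
      by_contra! h
      exact hA (ext_of_mulVec_single fun i => by rw [h, zero_mulVec])
    obtain ⟨U, u, h⟩ := exists_det_hankel_moment_ne_zero A hy ⟨y, rfl⟩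
    rw [hr] at h
    exact ⟨fun i => (U i, u i, (A *ᵥ y) i), h⟩

end Coins

/-! ### Distributed Krylov sequences -/

section DistributedKrylov

open Matrix

lemma hankel_eq_of_lt_or_le {n : ℕ} {R : Type*} (s : ℕ → R) (c : Fin 2) :
    hankel n s c = .of fun i j : Fin n =>
      if h : (i + j + c : ℕ) < n then s (⟨i + j + c, h⟩ : Fin n)
      else s ((⟨i + j + c - n, by omega⟩ : Fin n) + n) := by
  ext i j
  by_cases h : (i + j + c : ℕ) < n
  · simp only [hankel, of_apply, dif_pos h]
  · simp only [hankel, of_apply, dif_neg h, Nat.sub_add_cancel (not_lt.1 h)]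

variable {n β w M : ℕ} {F : Type u} [Field F]

/-- The first `N` columns of the square Krylov matrix of `B` and `v`, continued with zeros. -/
def truncatedKrylov (N : ℕ) (B : Matrix (Fin n) (Fin n) F) (v : Fin n → F) :
    Matrix (Fin n) (Fin n) F :=
  .of fun l j => if (j : ℕ) < N then (B ^ (j : ℕ) *ᵥ v) l else 0

lemma truncatedKrylov_two_mul_apply (N : ℕ) (B : Matrix (Fin n) (Fin n) F) (v : Fin n → F)
    (l j : Fin n) :
    truncatedKrylov (2 * N) B v l j =
      if (j : ℕ) < N then truncatedKrylov N B v l j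
      else (B ^ N * truncatedKrylov N B v) l ⟨j - N, by omega⟩ := by
  split_ifs with hjN
  · simp only [truncatedKrylov, of_apply, if_pos hjN, if_pos (show (j : ℕ) < 2 * N by omega)]
  · by_cases hj : (j : ℕ) < 2 * N
    · have hpow : B ^ (j : ℕ) *ᵥ v = B ^ N *ᵥ B ^ (j - N : ℕ) *ᵥ v := by
        rw [mulVec_mulVec, ← pow_add, Nat.add_sub_cancel' (by omega)]
      simp only [truncatedKrylov, of_apply, if_pos hj, hpow, mul_apply,
        if_pos (show (j - N : ℕ) < N by omega)]
      rfl
    · simp only [truncatedKrylov, of_apply, if_neg hj, mul_apply,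
        if_neg (show ¬ (j - N : ℕ) < N by omega), mul_zero, Finset.sum_const_zero]

lemma MulRounds.reach_truncatedKrylov (hM : MulRounds n β F M) {Ω : Type u}
    (B : Ω → Matrix (Fin n) (Fin n) F) (v : Ω → Fin n → F) (k : ℕ) :
    Reach β (k * (2 * M)) (fun ω l => (B ω l, v ω l))
      fun ω l => ((B ω ^ 2 ^ k) l, truncatedKrylov (2 ^ k) (B ω) (v ω) l) := by
  induction k with
  | zero =>
    rw [Nat.zero_mul]
    refine .of_local (fun _ s => (s.1, fun j => if (j : ℕ) < 1 then s.2 else 0)) fun ω l => ?_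
    refine Prod.ext (by simp) (funext fun j => if_ctx_congr Iff.rfl (fun hj => ?_) fun _ => rfl)
    rw [Nat.lt_one_iff.1 hj, pow_zero, one_mulVec]
  | succ k ih =>
    have hsquare := (hM (fun ω => B ω ^ 2 ^ k) fun ω => B ω ^ 2 ^ k).comap
      (X := fun ω l => ((B ω ^ 2 ^ k) l, truncatedKrylov (2 ^ k) (B ω) (v ω) l))
      (fun _ s => (s.1, s.1)) fun _ _ => rfl
    have hdouble := hsquare.prod
      (hM (fun ω => B ω ^ 2 ^ k) fun ω => truncatedKrylov (2 ^ k) (B ω) (v ω))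
    rw [pow_succ' 2 k, Nat.succ_mul]
    refine (ih.trans (Nat.two_mul M ▸ hdouble.keep)).map (fun _ s => (s.2.1, fun j : Fin n =>
      if (j : ℕ) < 2 ^ k then s.1.2 j else s.2.2 ⟨j - 2 ^ k, (Nat.sub_le _ _).trans_lt j.2⟩))
        fun ω l => ?_
    refine Prod.ext (by rw [two_mul, pow_add]) (funext fun j => ?_)
    exact truncatedKrylov_two_mul_apply (2 ^ k) (B ω) (v ω) l j

lemma MulRounds.reach_krylovCols (hM : MulRounds n β F M) {Ω : Type u}
    (B : Ω → Matrix (Fin n) (Fin n) F) (v : Ω → Fin n → F) :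
    Reach β (Nat.clog 2 n * (2 * M)) (fun ω l => (B ω l, v ω l))
      fun ω => krylovCols n (B ω) (v ω) := by
  refine (hM.reach_truncatedKrylov B v (Nat.clog 2 n)).map (fun _ s => s.2)
    fun ω l => funext fun j => ?_
  exact (if_pos (j.2.trans_le (Nat.le_pow_clog one_lt_two n))).symm

variable [Finite F]

lemma MulRounds.reach_krylovCols_moments (hM : MulRounds n β F M) (hF : FitsInMessages n β w F)
    {Ω : Type u} (B : Ω → Matrix (Fin n) (Fin n) F) (u v : Ω → Fin n → F) :
    Reach β (Nat.clog 2 n * (2 * M) + 2 * w) (fun ω l => (B ω l, u ω l, v ω l))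
      fun ω l => (krylovCols n (B ω) (v ω) l,
        fun j : Fin n => moment (B ω) (u ω) (v ω) j) := by
  have hcols := ((hM.reach_krylovCols B v).comap (X := fun ω l => (B ω l, u ω l, v ω l))
    (fun _ s => (s.1, s.2.2)) fun _ _ => rfl).keep
  have hsum := (Reach.sum_all hF fun ω l j =>
    u ω l * krylovCols n (B ω) (v ω) l j).comap
      (X := fun ω l => ((B ω l, u ω l, v ω l), krylovCols n (B ω) (v ω) l))
      (fun _ s j => s.1.2.1 * s.2 j) fun _ _ => rfl
  exact (hcols.trans hsum.keep).map (fun _ s => (s.1.2, s.2)) fun _ _ => rfl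

/-- What a node knows after the Krylov phase of Wiedemann's algorithm: its row of the Krylov
matrix, the first `n` moments, and the Hankel matrices of the moments shifted by `0` and by `1`. -/
def krylovData (B : Matrix (Fin n) (Fin n) F) (u v : Fin n → F) (l : Fin n) :
    (Fin n → F) × (Fin n → F) × (Fin 2 → Matrix (Fin n) (Fin n) F) :=
  (krylovCols n B v l, fun i => moment B u v i, fun c => hankel n (moment B u v) c)

lemma reach_pow_mulVec (hF : FitsInMessages n β w F) {Ω : Type*}
    (B : Ω → Matrix (Fin n) (Fin n) F) (v : Ω → Fin n → F) :
    Reach β w (fun ω l => (B ω l, krylovCols n (B ω) (v ω) l)) fun ω => B ω ^ n *ᵥ v ω := by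
  have hlast := (Reach.broadcast hF fun ω l =>
    krylovCols n (B ω) (v ω) l ⟨n - 1, Nat.sub_one_lt l.pos.ne'⟩).comap
      (X := fun ω l => (B ω l, krylovCols n (B ω) (v ω) l))
      (fun l s => s.2 ⟨n - 1, Nat.sub_one_lt l.pos.ne'⟩) fun _ _ => rfl
  refine hlast.keep.map (fun _ s => ∑ m, s.1.1 m * s.2 m) fun ω l => ?_
  rw [show B ω ^ n = B ω * B ω ^ (n - 1) by rw [← pow_succ', Nat.sub_add_cancel l.pos],
    ← mulVec_mulVec]
  rfl

lemma MulRounds.reach_krylovData (hM : MulRounds n β F M) (hF : FitsInMessages n β w F)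
    (hw : w ≤ M) {Ω : Type u} (B : Ω → Matrix (Fin n) (Fin n) F) (u v : Ω → Fin n → F) :
    Reach β (5 * ((Nat.clog 2 n + 1) * M)) (fun ω l => (B ω l, u ω l, v ω l))
      fun ω => krylovData (B ω) (u ω) (v ω) := by
  have hlow := (hM.reach_krylovCols_moments hF B u v).keep
  have hpow := hlow.trans ((reach_pow_mulVec hF B v).comap
    (fun _ s => (s.1.1, s.2.1)) fun _ _ => rfl).keep
  have hhigh := hpow.trans ((hM.reach_krylovCols_moments hF B u fun ω => B ω ^ n *ᵥ v ω).comap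
    (fun _ s => (s.1.1.1, s.1.1.2.1, s.2)) fun _ _ => rfl).keep
  refine (hhigh.map (fun _ s => (s.1.1.2.1, s.1.1.2.2, fun c : Fin 2 =>
    .of fun i j : Fin n => if h : (i + j + c : ℕ) < n then s.1.1.2.2 ⟨i + j + c, h⟩
      else s.2.2 ⟨i + j + c - n, by omega⟩)) fun ω l => ?_).mono ?_
  · simp only [krylovData, hankel_eq_of_lt_or_le _ (_ : Fin 2), moment_pow_mulVec]
  · nlinarith

lemma MulRounds.reach_krylovData_mul (hM : MulRounds n β F M) (hF : FitsInMessages n β w F)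
    (hw : w ≤ M) {Ω : Type u} (A U : Ω → Matrix (Fin n) (Fin n) F) (u v : Ω → Fin n → F) :
    Reach β (6 * ((Nat.clog 2 n + 1) * M)) (fun ω l => (A ω l, U ω l, u ω l, v ω l))
      fun ω => krylovData (A ω * U ω) (u ω) (v ω) := by
  have hmul := ((hM A U).comap (X := fun ω l => (A ω l, U ω l, u ω l, v ω l))
    (fun _ s => (s.1, s.2.1)) fun _ _ => rfl).keep
  have hdata := (hM.reach_krylovData hF hw (fun ω => A ω * U ω) u v).comap
    (X := fun ω l => ((A ω l, U ω l, u ω l, v ω l), (A ω * U ω) l))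
    (fun _ s => (s.2, s.1.2.2)) fun _ _ => rfl
  exact (hmul.trans hdata).mono (by nlinarith)

end DistributedKrylov

/-! ### The three problems -/

section Problems

open Matrix

variable {n β w M T : ℕ} {F : Type u}

/-- In `T` rounds, all nodes can learn an `n × n` matrix over `F` of which every node initially
knows its row. -/
def CollectRounds (n β : ℕ) (F : Type u) (T : ℕ) : Prop :=
  ∀ {Ω : Type u} (A : Ω → Matrix (Fin n) (Fin n) F), Reach β T (fun ω => A ω) fun ω _ => A ω

lemma collectRounds_one : CollectRounds 1 β F 0 := fun A =>
  .of_local (fun _ s _ => s) fun ω l => funext fun i => congrArg (A ω) (Subsingleton.elim i l)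

lemma FitsInMessages.collectRounds [Finite F] [Nonempty F] (hF : FitsInMessages n β w F) :
    CollectRounds n β F (n * w) := fun A =>
  (Reach.pi fun j => (Reach.broadcast hF fun ω l => A ω l j).comap (X := A) (fun _ s => s j)
    fun _ _ => rfl).map (fun _ s i j => s j i) fun _ _ => rfl

lemma CollectRounds.solvableInRounds (hT : CollectRounds n β F T) (prob : Problem.{u, w} n)
    (A : prob.Instance → Matrix (Fin n) (Fin n) F) (row : prob.LocalInput → Fin n → F)
    (hrow : ∀ X l, row (prob.localInput X l) = A X l)
    (solve : Fin n → Matrix (Fin n) (Fin n) F → prob.LocalInput → prob.LocalOutput)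
    (hsolve : ∀ X, prob.Correct X fun l => solve l (A X) (prob.localInput X l)) :
    SolvableInRounds prob β T 0 := by
  refine solvableInRounds_of_reach (Coin := PUnit)
    (Y := fun ω l => solve l (A ω.1) (prob.localInput ω.1 l)) ?_ fun X => ?_
  · exact ((hT fun ω : prob.Instance × (Fin n → PUnit) => A ω.1).comap
      (fun _ s => row s.1) fun ω l => (hrow ω.1 l).symm).keep.map
        (fun l s => solve l s.2 s.1.1) fun _ _ => rfl
  · simp only [hsolve, not_true_eq_false, Set.ofPred_false, uniformProb_empty, le_refl]

variable [Field F]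

lemma CollectRounds.solvableInRounds_det (hT : CollectRounds n β F T) :
    SolvableInRounds (DET n F) β T 0 :=
  hT.solvableInRounds (DET n F) id Prod.fst (fun _ _ => rfl) (fun _ A _ => A.det) fun _ _ => rfl

lemma CollectRounds.solvableInRounds_rank (hT : CollectRounds n β F T) :
    SolvableInRounds (RANK n F) β T 0 :=
  hT.solvableInRounds (RANK n F) id Prod.fst (fun _ _ => rfl) (fun _ A _ => A.rank) fun _ _ => rfl

lemma CollectRounds.solvableInRounds_sys (hT : CollectRounds n β F T) :
    SolvableInRounds (SYS n F) β T 0 :=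
  hT.solvableInRounds (SYS n F) (fun X => X.1.1) (fun x => x.1.1) (fun _ _ => rfl)
    (fun l A x => (A⁻¹ *ᵥ x.2) l) fun X => by
      have hdet := (isUnit_iff_isUnit_det X.1.1).1 X.1.2
      exact (mulVec_mulVec ..).trans (by rw [mul_nonsing_inv _ hdet, one_mulVec])

variable [Finite F]

lemma MulRounds.solvableInRounds_det (hM : MulRounds n β F M) (hF : FitsInMessages n β w F)
    (hw : w ≤ M) :
    SolvableInRounds (DET n F) β (11 * ((Nat.clog 2 n + 1) * M))
      (6 * (n : ℝ) ^ 2 / Nat.card F) := by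
  let Ω := Matrix (Fin n) (Fin n) F × (Fin n → WiedemannCoin n F)
  refine solvableInRounds_of_reach (prob := DET n F) (Coin := WiedemannCoin n F)
    (Y := fun (ω : Ω) _ =>
      (hankel n (moment (ω.1 * coinMatrix ω.2) (coinLeft ω.2) (coinRight ω.2)) 1).det /
        (hankel n (moment (ω.1 * coinMatrix ω.2) (coinLeft ω.2) (coinRight ω.2)) 0).det /
      ((hankel n (moment (coinMatrix ω.2) (coinLeft ω.2) (coinRight ω.2)) 1).det /
        (hankel n (moment (coinMatrix ω.2) (coinLeft ω.2) (coinRight ω.2)) 0).det))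
    ?_ fun (A : Matrix (Fin n) (Fin n) F) => ?_
  · have hAU := (hM.reach_krylovData_mul hF hw (fun ω : Ω => ω.1) (fun ω => coinMatrix ω.2)
      (fun ω => coinLeft ω.2) fun ω => coinRight ω.2).comap
        (X := fun ω l => (rowAndColumn ω.1 l, ω.2 l))
        (fun _ s => (s.1.1, s.2.1, s.2.2.1, s.2.2.2)) fun _ _ => rfl
    have hU := (hM.reach_krylovData hF hw (fun ω : Ω => coinMatrix ω.2)
      (fun ω => coinLeft ω.2) fun ω => coinRight ω.2).comap
        (X := fun ω l => (rowAndColumn ω.1 l, ω.2 l))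
        (fun _ s => (s.2.1, s.2.2.1, s.2.2.2)) fun _ _ => rfl
    exact ((hAU.prod hU).map (fun _ s => (s.1.2.2 1).det / (s.1.2.2 0).det /
      ((s.2.2.2 1).det / (s.2.2.2 0).det)) fun _ _ => rfl).mono (by omega)
  · have hA := uniformProb_and_le (by positivity) fun hA : IsUnit A =>
      uniformProb_det_hankel_eq_zero_le_of_rank ((rank_of_isUnit A hA).trans (Fintype.card_fin n))
    have hU := uniformProb_det_hankel_eq_zero_le_of_rank
      ((rank_one (R := F) (n := Fin n)).trans (Fintype.card_fin n))
    simp only [one_mul] at hU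
    refine (uniformProb_mono fun x hx => ?_).trans
      ((uniformProb_union_le _ _).trans ((add_le_add hA hU).trans (le_of_eq (by ring))))
    by_contra! h
    simp only [Set.mem_union, Set.mem_ofPred_eq, not_or, not_and] at h
    exact hx fun _ => det_hankel_div_div h.1 h.2

lemma MulRounds.solvableInRounds_rank (hM : MulRounds n β F M) (hF : FitsInMessages n β w F)
    (hw : w ≤ M) :
    SolvableInRounds (RANK n F) β (6 * ((Nat.clog 2 n + 1) * M))
      (3 * (n : ℝ) ^ 2 / Nat.card F) := by
  let Ω := Matrix (Fin n) (Fin n) F × (Fin n → WiedemannCoin n F)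
  refine solvableInRounds_of_reach (prob := RANK n F) (Coin := WiedemannCoin n F)
    (Y := fun (ω : Ω) _ =>
      (hankel n (moment (ω.1 * coinMatrix ω.2) (coinLeft ω.2) (coinRight ω.2)) 1).rank)
    ?_ fun (A : Matrix (Fin n) (Fin n) F) => ?_
  · exact ((hM.reach_krylovData_mul hF hw (fun ω : Ω => ω.1) (fun ω => coinMatrix ω.2)
      (fun ω => coinLeft ω.2) fun ω => coinRight ω.2).comap
      (fun _ s => (s.1.1, s.2.1, s.2.2.1, s.2.2.2)) fun _ _ => rfl).map
        (fun _ s => (s.2.2 1).rank) fun _ _ => rfl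
  · refine (uniformProb_mono fun x hx => ?_).trans (uniformProb_det_hankel_eq_zero_le_of_rank
      (A := A) rfl)
    by_contra h
    exact hx fun _ => rank_hankel_of_det_ne_zero h

lemma MulRounds.solvableInRounds_sys (hM : MulRounds n β F M) (hF : FitsInMessages n β w F)
    (hw : w ≤ M) :
    SolvableInRounds (SYS n F) β (7 * ((Nat.clog 2 n + 1) * M))
      (3 * (n : ℝ) ^ 2 / Nat.card F) := by
  let Ω := (SYS n F).Instance × (Fin n → WiedemannCoin n F)
  let B (ω : Ω) := ω.1.1.1 * coinMatrix ω.2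
  let s (ω : Ω) := moment (B ω) (coinLeft ω.2) ω.1.2
  let y (ω : Ω) := krylovCols n (B ω) ω.1.2 *ᵥ (hankel n (s ω) 1)⁻¹ *ᵥ fun i : Fin n => s ω i
  let z (ω : Ω) : Fin n → F := coinMatrix ω.2 *ᵥ y ω
  refine solvableInRounds_of_reach (prob := SYS n F) (Coin := WiedemannCoin n F)
    (Y := z) ?_ fun X => ?_
  · have hy : Reach β (6 * ((Nat.clog 2 n + 1) * M))
        (fun (ω : Ω) l => ((SYS n F).localInput ω.1 l, ω.2 l)) y :=
      ((hM.reach_krylovData_mul hF hw (fun ω : Ω => ω.1.1.1) (fun ω => coinMatrix ω.2)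
        (fun ω => coinLeft ω.2) fun ω => ω.1.2).comap
          (fun l s => (s.1.1.1, s.2.1, s.2.2.1, s.1.2 l)) fun _ _ => rfl).map
            (fun _ s => s.1 ⬝ᵥ ((s.2.2 1)⁻¹ *ᵥ s.2.1)) fun _ _ => rfl
    exact ((hy.trans (Reach.broadcast hF y)).keep.map (fun _ s => s.1.2.1 ⬝ᵥ s.2)
      fun _ _ => rfl).mono (by nlinarith)
  · have hX := uniformProb_and_le (by positivity) fun hb : X.2 ≠ 0 =>
      uniformProb_det_hankel_eq_zero_le_of_isUnit X.1.2 hb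
    refine (uniformProb_mono fun x hx => ?_).trans hX
    by_contra h
    exact hx <| (mulVec_mulVec ..).trans <|
      mulVec_krylovCols_hankel_inv fun hb hdet => h ⟨hb, hdet⟩

end Problems

/-! ### Round complexity -/

section RoundComplexity

lemma log_two_le_log_natCast {n : ℕ} (hn : 2 ≤ n) : Real.log 2 ≤ Real.log n :=
  Real.log_le_log two_pos (by exact_mod_cast hn)

lemma clog_two_add_one_le {n : ℕ} (hn : 2 ≤ n) :
    ((Nat.clog 2 n + 1 : ℕ) : ℝ) ≤ 5 * Real.log n := by
  have hlog := log_two_le_log_natCast hn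
  have hlog2 := Real.log_two_gt_d9
  have hclog : (Nat.clog 2 n : ℝ) < Real.log n / Real.log 2 + 1 := by
    rw [← Real.natCeil_logb_natCast]
    exact Nat.ceil_lt_add_one (Real.logb_nonneg one_lt_two (by exact_mod_cast one_le_two.trans hn))
  have hdiv : Real.log n / Real.log 2 * Real.log 2 = Real.log n :=
    div_mul_cancel₀ _ (by positivity)
  push_cast
  nlinarith

lemma exists_fitsInMessages (K : ℝ) (k : ℕ) {β : ℕ} (hβ : 1 ≤ β) :
    ∃ w, ∀ (n : ℕ) (V : Type u), 2 ≤ n → (Nat.card V : ℝ) ≤ K * (n : ℝ) ^ k →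
      FitsInMessages n β w V := by
  obtain ⟨a, ha⟩ := pow_unbounded_of_one_lt K (one_lt_two (α := ℝ))
  refine ⟨a + k, fun n V hn hV => ?_⟩
  have hclog : 1 ≤ Nat.clog 2 n := Nat.clog_pos one_lt_two hn
  have hcard : Nat.card V ≤ 2 ^ a * n ^ k := by
    have hle : (Nat.card V : ℝ) ≤ 2 ^ a * (n : ℝ) ^ k := hV.trans (by gcongr)
    exact_mod_cast hle
  calc Nat.card V ≤ 2 ^ a * (2 ^ Nat.clog 2 n) ^ k := by
        grw [hcard, ← Nat.le_pow_clog one_lt_two n]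
    _ = 2 ^ (1 * a + Nat.clog 2 n * k) := by rw [one_mul, pow_add, pow_mul]
    _ ≤ 2 ^ (β * Nat.clog 2 n * (a + k)) := by
        gcongr
        · exact one_le_two
        · nlinarith [Nat.mul_le_mul hβ hclog, Nat.mul_le_mul_right (Nat.clog 2 n) hβ]

variable {c d q : ℝ} {n : ℕ}

lemma error_mul_log_le (hc : 0 < c) (hq : 0 < q) (h : c * (n : ℝ) ^ 2 * Real.log n ≤ q) :
    d * (n : ℝ) ^ 2 / q * Real.log n ≤ |d| / c := by
  rw [div_mul_eq_mul_div, div_le_div_iff₀ hq hc]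
  calc d * (n : ℝ) ^ 2 * Real.log n * c = d * (c * (n : ℝ) ^ 2 * Real.log n) := by ring
    _ ≤ |d| * q := by
      have := Real.log_natCast_nonneg n
      gcongr
      exact le_abs_self d

lemma le_exp_of_one_third_lt_error (hc : 0 < c) (hn : 1 ≤ n) (hq : 0 < q)
    (h : c * (n : ℝ) ^ 2 * Real.log n ≤ q) (hδ : 1 / 3 < d * (n : ℝ) ^ 2 / q) :
    (n : ℝ) ≤ Real.exp (3 * d / c) := by
  have hn0 : (0 : ℝ) < n := by exact_mod_cast hn
  rw [← Real.log_le_iff_le_exp hn0, le_div_iff₀ hc]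
  rw [div_lt_div_iff₀ three_pos hq] at hδ
  have hsq : (Real.log n * c) * (n : ℝ) ^ 2 < 3 * d * (n : ℝ) ^ 2 := by linarith
  exact (lt_of_mul_lt_mul_right hsq (by positivity)).le

lemma rounds_le {a M : ℕ} {C e e' : ℝ} (hn : 2 ≤ n) (he : e' ≤ e) (hM : (M : ℝ) ≤ C * n ^ e') :
    ((a * ((Nat.clog 2 n + 1) * M) : ℕ) : ℝ) ≤ 5 * a * |C| * (n ^ e * Real.log n) := by
  have hM' : (M : ℝ) ≤ |C| * n ^ e := by
    grw [hM, le_abs_self C, he]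
    exact_mod_cast one_le_two.trans hn
  rw [Nat.cast_mul, Nat.cast_mul]
  calc a * (((Nat.clog 2 n + 1 : ℕ) : ℝ) * M)
      ≤ a * (5 * Real.log n * (|C| * n ^ e)) := by
        gcongr
        exact clog_two_add_one_le hn
    _ = 5 * a * |C| * (n ^ e * Real.log n) := by ring

lemma half_le_rpow_mul_log {e : ℝ} (hn : 2 ≤ n) (he : 0 ≤ e) :
    1 / 2 ≤ (n : ℝ) ^ e * Real.log n := by
  have hlog := log_two_le_log_natCast hn
  have hlog2 := Real.log_two_gt_d9
  have hpow : 1 ≤ (n : ℝ) ^ e := Real.one_le_rpow (by exact_mod_cast one_le_two.trans hn) he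
  nlinarith

lemma randomizedRoundComplexityO_of_mulRounds {ι : Type v} {F : ι → Type u} [∀ i, Field (F i)]
    [∀ i, Finite (F i)] {K e τ : ℝ} {k β a : ℕ} (hc : 0 < c) (hβ : 1 ≤ β)
    (hτ : MatMulRankO F τ) (hτ2 : 2 ≤ τ) (he : 1 - 2 / τ ≤ e)
    {prob : (n : ℕ) → ι → Problem.{u, w} n}
    (hcollect : ∀ n i T, CollectRounds n β (F i) T → SolvableInRounds (prob n i) β T 0)
    (hmul : ∀ n i w M, FitsInMessages n β w (F i) → w ≤ M → MulRounds n β (F i) M →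
      SolvableInRounds (prob n i) β (a * ((Nat.clog 2 n + 1) * M))
        (d * (n : ℝ) ^ 2 / Nat.card (F i))) :
    RandomizedRoundComplexityO (FieldSizeAdmissible F c K k) prob β
      fun n => (n : ℝ) ^ e * Real.log n := by
  obtain ⟨w, hw⟩ := exists_fitsInMessages K k hβ
  obtain ⟨C, hC⟩ := hτ.exists_mulRounds (by linarith) β w
  have he0 : 0 ≤ e := he.trans' (sub_nonneg.2 ((div_le_one (by linarith)).2 hτ2))
  refine ⟨max (5 * a * |C|) (2 * (Real.exp (3 * d / c) * w)), |d| / c,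
    fun n i ⟨hn, hlow, hup⟩ => ?_⟩
  have hdc : 0 * Real.log n ≤ |d| / c := by
    rw [zero_mul]
    positivity
  obtain rfl | hn2 : n = 1 ∨ 2 ≤ n := by omega
  · exact ⟨0, 0, by simp, by norm_num, hdc, hcollect 1 i 0 collectRounds_one⟩
  have hF := hw n (F i) hn2 hup
  have hcard : (0 : ℝ) < Nat.card (F i) := by exact_mod_cast Nat.card_pos
  have hf := half_le_rpow_mul_log hn2 he0
  obtain hδ | hδ := le_or_gt (d * (n : ℝ) ^ 2 / Nat.card (F i)) (1 / 3)
  · obtain ⟨M, hwM, hMC, hM⟩ := hC i n hn hF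
    refine ⟨_, _, (rounds_le hn2 he hMC).trans ?_, hδ, error_mul_log_le hc hcard hlow,
      hmul n i w M hF hwM hM⟩
    gcongr
    exact le_max_left ..
  · refine ⟨n * w, 0, ?_, by norm_num, hdc, hcollect n i _ hF.collectRounds⟩
    have hnN := le_exp_of_one_third_lt_error hc hn hcard hlow hδ
    calc ((n * w : ℕ) : ℝ) ≤ Real.exp (3 * d / c) * w := by
          push_cast
          gcongr
      _ ≤ 2 * (Real.exp (3 * d / c) * w) * (n ^ e * Real.log n) := by
          nlinarith [mul_nonneg (Real.exp_pos (3 * d / c)).le (Nat.cast_nonneg (α := ℝ) w)]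
      _ ≤ _ := by
          gcongr
          exact le_max_right ..

end RoundComplexity

end CongestedClique

theorem theorem3 {ι : Type v} (F : ι → Type u) [∀ i, Field (F i)] [∀ i, Finite (F i)]
    (c K : ℝ) (hc : 0 < c) (k β : ℕ) (hβ : 1 ≤ β) (e : ℝ)
    -- the exponent `1 - 2 / ω`, up to an arbitrarily small `ε`, or the exact `1 - 2 / τ` for
    -- every exponent `τ` for which the rank is `O(m ^ τ)`
    (he : (∃ ε : ℝ, 0 < ε ∧ e = 1 - 2 / matMulExponent F + ε) ∨
      (∃ τ : ℝ, MatMulRankO F τ ∧ e = 1 - 2 / τ)) :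
    RandomizedRoundComplexityO (FieldSizeAdmissible F c K k) (fun n i => DET n (F i)) β
        (fun n => (n : ℝ) ^ e * Real.log n) ∧
      RandomizedRoundComplexityO (FieldSizeAdmissible F c K k) (fun n i => SYS n (F i)) β
        (fun n => (n : ℝ) ^ e * Real.log n) ∧
      RandomizedRoundComplexityO (FieldSizeAdmissible F c K k) (fun n i => RANK n (F i)) β
        (fun n => (n : ℝ) ^ e * Real.log n) := by
  obtain hι | hι := isEmpty_or_nonempty ι
  · exact ⟨⟨0, 0, fun _ i => hι.elim i⟩, ⟨0, 0, fun _ i => hι.elim i⟩,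
      ⟨0, 0, fun _ i => hι.elim i⟩⟩
  obtain ⟨τ, hτ, hle⟩ : ∃ τ, MatMulRankO F τ ∧ 1 - 2 / τ ≤ e := by
    obtain ⟨ε, hε, rfl⟩ | ⟨τ, hτ, rfl⟩ := he
    · exact ⟨_, matMulRankO_matMulExponent_add hε,
        one_sub_two_div_add_le two_le_matMulExponent hε.le⟩
    · exact ⟨τ, hτ, le_rfl⟩
  refine ⟨?det, ?sys, ?rank⟩
  case det =>
    exact randomizedRoundComplexityO_of_mulRounds hc hβ hτ hτ.two_le hle
      (fun _ _ _ hT => hT.solvableInRounds_det)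
      fun _ _ _ _ hF hw hM => hM.solvableInRounds_det hF hw
  case sys =>
    exact randomizedRoundComplexityO_of_mulRounds hc hβ hτ hτ.two_le hle
      (fun _ _ _ hT => hT.solvableInRounds_sys)
      fun _ _ _ _ hF hw hM => hM.solvableInRounds_sys hF hw
  case rank =>
    exact randomizedRoundComplexityO_of_mulRounds hc hβ hτ hτ.two_le hle
      (fun _ _ _ hT => hT.solvableInRounds_rank)
      fun _ _ _ _ hF hw hM => hM.solvableInRounds_rank hF hw
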